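/- Let $n\ge 1$, $\beta>0$, let $p\ge 2$ be an integer, and let $\mathbb K=\mathbb R$ or $\mathbb C$; $\mathcal S,\mathcal S'$ are the Schwartz functions and tempered distributions on $\mathbb R^n$ with scalars $\mathbb K$. For $t>0$ put $K_\beta(t,\cdot)=\mathcal F^{-1}(e^{-t|\xi|^\beta})\in L^1(\mathbb R^n)$ (with $\mathcal F^{-1}g(x)=\int e^{2\pi i\langle x,\xi\rangle}g(\xi)\,d\xi$) and $S_\beta(t)u=K_\beta(t,\cdot)*u$. Here $k*u$, for $k\in L^1(\mathbb R^n)$, is defined for bounded distributions $u\in\mathcal S'$ (those for which $y\mapsto\langle T_yu,\varphi\rangle$ is bounded for every $\varphi\in\mathcal S$, where $T_yu=u(\cdot-y)$) by $\langle k*u,\varphi\rangle=\int k(y)\langle T_yu,\varphi\rangle\,dy$. Write $u_\lambda=u(\lambda\,\cdot)$. Let $E$ be a Banach space over $\mathbb K$ with $\mathcal S\subset E\subset\mathcal S'$, both injections continuous, and let $B:E^p\to\mathcal S'$ be $p$-linear. Assume: * $E$ has scaling degree $a\in\mathbb R$: for $u\in E$, $\lambda>0$ we have $u_\lambda\in E$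 and $\|u_\lambda\|_E=\lambda^a\|u\|_E$. $B$ has scaling degree $\sigma\in\mathbb R$: $B((u_1)_\lambda,\dots,(u_p)_\lambda)=\lambda^\sigma[B(u_1,\dots,u_p)]_\lambda$. * $E\in\mathcal X$: there are $t_0>0$ and $r_0\in[1,\infty]$ such that $S_\beta(t_0):E\to L^{r_0}(\mathbb R^n)$ is bounded. * $E$ is adequate: $T_yu\in E$ with $\|T_yu\|_E=\|u\|_E$ for all $u\in E$, $y\in\mathbb R^n$; $k*u\in E$ with $\|k*u\|_E\le\|k\|_{L^1}\|u\|_E$ for all $u\in E$ and all real $k\in L^1(\mathbb R^n)$; and there is $\omega:(0,\infty)\to(0,\infty)$, integrable on $(0,T)$ for every $T<\infty$, such that $S_\beta(t)B(u_1,\dots,u_p)\in E$ and $\|S_\beta(t)B(u_1,\dots,u_p)\|_E\le\omega(t)\prod_i\|u_i\|_E$ for all $t>0$, $u_i\in E$. * $\dfrac{\beta-\sigma}{p-1}-\dfrac{\beta}{p}<-a<\dfrac{\beta-\sigma}{p-1}$, and $\alpha=\dfrac{\beta-\sigma}{p-1}+a$. Let $BE^\alpha$ be the set of $u\in\mathcal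 S'$ with $\|u\|_{BE^\alpha}=\sup_{t>0}t^{\alpha/\beta}\|S_\beta(t)u\|_E<\infty$. A global (mild) solution with datum $u_0$ is a function $u:(0,\infty)\to E$ in $L^\infty((0,\infty);BE^\alpha)$ with $\sup_{t>0}t^{\alpha/\beta}\|u(t)\|_E<\infty$ and $$u(t)=S_\beta(t)u_0+\int_0^tS_\beta(t-\tau)B(u(\tau),\dots,u(\tau))\,d\tau\qquad(t>0),$$ with a Bochner integral in $E$. Put $\|u\|:=\sup_{t>0}\|u(t)\|_{BE^\alpha}+\sup_{t>0}t^{\alpha/\beta}\|u(t)\|_E$. Then there are constants $C_1,C_2>0$ such that, for all $t>0$ and $u_i\in E$, $$\|S_\beta(t)B(u_1,\dots,u_p)\|_E\le C_1t^{\frac{(p-1)a-\sigma}{\beta}}\prod_i\|u_i\|_E,\qquad \|S_\beta(t)B(u_1,\dots,u_p)\|_{BE^\alpha}\le C_2t^{\frac{\alpha+(p-1)a-\sigma}{\beta}}\prod_i\|u_i\|_E .$$ For any such constants put $K_1=C_1\int_0^1(1-\tau)^{\frac{(p-1)a-\sigma}{\beta}}\tau^{-\frac{p\alpha}{\beta}}d\tau$,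 $K_2=C_2\int_0^1(1-\tau)^{\frac{(p-1)a-\sigma+\alpha}{\beta}}\tau^{-\frac{p\alpha}{\beta}}d\tau$ and $K=K_1+K_2$, and let $M,R>0$ satisfy $2R+pKM^{p}<M$. Then: 1. For every $u_0\in BE^\alpha$ with $\|u_0\|_{BE^\alpha}\le R$ there is a unique global solution $u$ with datum $u_0$ and $\|u\|\le M$. 2. If $u,v$ are global solutions with data $u_0,v_0$, where $\|u_0\|_{BE^\alpha},\|v_0\|_{BE^\alpha}\le R$ and $\|u\|,\|v\|\le M$, then $\|u-v\|\le 2\,[1-pKM^{p-1}]^{-1}\|u_0-v_0\|_{BE^\alpha}$. 3. In the situation of 2, if $pK_1M^{p-1}<1$, then $\lim_{t\to\infty}t^{\alpha/\beta}\|u(t)-v(t)\|_E=0$ if and only if $\lim_{t\to\infty}t^{\alpha/\beta}\|S_\beta(t)(u_0-v_0)\|_E=0$. -/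

import Mathlib

open MeasureTheory Filter Topology Set
open scoped SchwartzMap ENNReal NNReal FourierTransform

noncomputable section

namespace FracHeat

/-- The Euclidean space `ℝⁿ`. -/
abbrev Space (n : ℕ) := EuclideanSpace ℝ (Fin n)

/-- Tempered distributions on `ℝⁿ` with scalars `𝕜 = ℝ` or `ℂ` (for `𝕜 = ℂ` this is Mathlib's
`𝓢'(ℝⁿ, ℂ)`). -/
abbrev Distr (n : ℕ) (𝕜 : Type*) [RCLike 𝕜] := 𝓢(Space n, 𝕜) →Lₚₜ[𝕜] 𝕜

section Distributions

variable {𝕜 : Type*} [RCLike 𝕜] {n : ℕ}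

/-- The translate `T_y u = u(· - y)`, that is `⟨T_y u, φ⟩ = ⟨u, φ(· + y)⟩`. -/
def translate (y : Space n) (u : Distr n 𝕜) : Distr n 𝕜 :=
  PointwiseConvergenceCLM.precomp 𝕜 (SchwartzMap.compSubConstCLM 𝕜 (-y)) u

/-- The dilate `u_lam = u(lam ·)`, that is `⟨u_lam, φ⟩ = lam⁻ⁿ ⟨u, φ(lam⁻¹ ·)⟩`. -/
def dilate (lam : ℝ) (hlam : 0 < lam) (u : Distr n 𝕜) : Distr n 𝕜 :=
  (((lam ^ n)⁻¹ : ℝ) : 𝕜) • PointwiseConvergenceCLM.precomp 𝕜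
    (SchwartzMap.compCLMOfContinuousLinearEquiv 𝕜
      (ContinuousLinearEquiv.smulLeft (M₁ := Space n) (R₁ := ℝ) (Units.mk0 lam hlam.ne')⁻¹)) u

/-- `u` is a bounded distribution: `y ↦ ⟨T_y u, φ⟩` is bounded for every test function `φ`.
This is the class of tempered distributions that can be convolved with every `L¹` function. -/
def IsBoundedDistr (u : Distr n 𝕜) : Prop :=
  ∀ φ : 𝓢(Space n, 𝕜), ∃ C : ℝ, ∀ y : Space n, ‖translate y u φ‖ ≤ C

/-- `v = k * u`, where `u` is a bounded distribution: `v = ∫ k(y) T_y u dy` in the sense of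
distributions. -/
def IsConv (k : Space n → ℝ) (u v : Distr n 𝕜) : Prop :=
  IsBoundedDistr u ∧ ∀ φ : 𝓢(Space n, 𝕜), v φ = ∫ y, k y • translate y u φ

/-- The kernel `K_β(t, ·) = 𝓕⁻¹(exp (-t |ξ|^β))`, with the normalization `exp (2πi⟨x, ξ⟩)`;
it is real valued because the symbol is real and even. -/
def kernel (β t : ℝ) (x : Space n) : ℝ :=
  (𝓕⁻ (fun ξ : Space n => ((Real.exp (-t * ‖ξ‖ ^ β) : ℝ) : ℂ)) x).re

/-- `v = S_β(t) u = K_β(t, ·) * u`. -/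
def IsHeat (β t : ℝ) (u v : Distr n 𝕜) : Prop :=
  IsConv (kernel β t) u v

end Distributions

section Spaces

variable {𝕜 : Type*} [RCLike 𝕜] {n : ℕ}
  {E : Type*} [NormedAddCommGroup E] [NormedSpace 𝕜 E]

/-- `‖S_β(t) u‖_E`, with the value `∞` if `S_β(t) u` does not belong to `E`. -/
def heatNorm (β : ℝ) (ι : E →L[𝕜] Distr n 𝕜) (t : ℝ) (u : Distr n 𝕜) : ℝ≥0∞ :=
  ⨅ (e : E) (_ : IsHeat β t u (ι e)), ‖e‖ₑ

/-- `‖u‖_{BE^α} = sup_{t > 0} t^{α/β} ‖S_β(t) u‖_E ∈ [0, ∞]`;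
the space `BE^α` consists of the `u` for which this is finite. -/
def BENorm (β α : ℝ) (ι : E →L[𝕜] Distr n 𝕜) (u : Distr n 𝕜) : ℝ≥0∞ :=
  ⨆ (t : ℝ) (_ : 0 < t), ENNReal.ofReal (t ^ (α / β)) * heatNorm β ι t u

/-- `E` (embedded by `ι`) has scaling degree `a`: `‖u_lam‖_E = lam^a ‖u‖_E`. -/
def SpaceScaling (ι : E →L[𝕜] Distr n 𝕜) (a : ℝ) : Prop :=
  ∀ (u : E) (lam : ℝ) (hlam : 0 < lam),
    ∃ v : E, ι v = dilate lam hlam (ι u) ∧ ‖v‖ = lam ^ a * ‖u‖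

/-- The `p`-linear form `B` has scaling degree `σ`:
`B((u₁)_lam, …, (u_p)_lam) = lam^σ [B(u₁, …, u_p)]_lam`. -/
def FormScaling {p : ℕ} (ι : E →L[𝕜] Distr n 𝕜)
    (B : MultilinearMap 𝕜 (fun _ : Fin p => E) (Distr n 𝕜)) (σ : ℝ) : Prop :=
  ∀ (lam : ℝ) (hlam : 0 < lam) (u v : Fin p → E),
    (∀ i, ι (v i) = dilate lam hlam (ι (u i))) →
      B v = ((lam ^ σ : ℝ) : 𝕜) • dilate lam hlam (B u)

/-- `E` belongs to the class `𝒳`: `S_β(t₀) : E → L^{r₀}(ℝⁿ)` is bounded for some `t₀ > 0` and some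
`r₀ ∈ [1, ∞]`. -/
def InClassX (β : ℝ) (ι : E →L[𝕜] Distr n 𝕜) : Prop :=
  ∃ t₀ : ℝ, 0 < t₀ ∧ ∃ r₀ : ℝ≥0∞, 1 ≤ r₀ ∧ ∃ C : ℝ≥0, ∀ u : E,
    ∃ (w : Distr n 𝕜) (f : Space n → 𝕜), IsHeat β t₀ (ι u) w ∧
      MemLp f r₀ volume ∧ (∀ φ : 𝓢(Space n, 𝕜), w φ = ∫ x, φ x * f x) ∧
      eLpNorm f r₀ volume ≤ C * ‖u‖ₑ

/-- `E` is adequate to the problem `∂ₜu + (-Δ)^{β/2} u = B(u, …, u)`. -/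
structure Adequate (β : ℝ) {p : ℕ} (ι : E →L[𝕜] Distr n 𝕜)
    (B : MultilinearMap 𝕜 (fun _ : Fin p => E) (Distr n 𝕜)) : Prop where
  /-- `E ⊂ 𝓢'` with continuous injection -/
  injective : Function.Injective ι
  /-- `𝓢 ⊂ E` with continuous injection -/
  schwartz_subset : ∃ j : 𝓢(Space n, 𝕜) →L[𝕜] E,
    ∀ φ ψ : 𝓢(Space n, 𝕜), ι (j φ) ψ = ∫ x, ψ x * φ x
  /-- the norm is invariant by translations -/
  translation : ∀ (u : E) (y : Space n), ∃ v : E, ι v = translate y (ι u) ∧ ‖v‖ = ‖u‖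
  /-- translation invariance in integrated form: `‖k * u‖_E ≤ ‖k‖_{L¹} ‖u‖_E` -/
  convolution : ∀ (u : E) (k : Space n → ℝ), Integrable k →
    ∃ v : E, IsConv k (ι u) (ι v) ∧ ‖v‖ ≤ (∫ y, |k y|) * ‖u‖
  /-- `‖S_β(t) B(u₁, …, u_p)‖_E ≤ ω(t) ∏ ‖u_i‖_E` with `ω > 0` integrable on each `(0, T)` -/
  form_bound : ∃ ω : ℝ → ℝ, (∀ t, 0 < t → 0 < ω t) ∧ (∀ T, 0 < T → IntegrableOn ω (Ioo 0 T)) ∧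
    ∀ t, 0 < t → ∀ u : Fin p → E,
      heatNorm β ι t (B u) ≤ ENNReal.ofReal (ω t * ∏ i, ‖u i‖)

/-- `‖S_β(t) B(u₁, …, u_p)‖_E ≤ C₁ t^{((p-1)a-σ)/β} ∏ ‖u_i‖_E` for all `t > 0`. -/
def EstimateE (β a σ : ℝ) {p : ℕ} (ι : E →L[𝕜] Distr n 𝕜)
    (B : MultilinearMap 𝕜 (fun _ : Fin p => E) (Distr n 𝕜)) (C₁ : ℝ) : Prop :=
  ∀ t, 0 < t → ∀ u : Fin p → E, heatNorm β ι t (B u) ≤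
    ENNReal.ofReal (C₁ * t ^ ((((p : ℝ) - 1) * a - σ) / β) * ∏ i, ‖u i‖)

/-- `‖S_β(t) B(u₁, …, u_p)‖_{BE^α} ≤ C₂ t^{(α+(p-1)a-σ)/β} ∏ ‖u_i‖_E` for all `t > 0`. -/
def EstimateBE (β a σ α : ℝ) {p : ℕ} (ι : E →L[𝕜] Distr n 𝕜)
    (B : MultilinearMap 𝕜 (fun _ : Fin p => E) (Distr n 𝕜)) (C₂ : ℝ) : Prop :=
  ∀ t, 0 < t → ∀ u : Fin p → E, ∃ w : Distr n 𝕜, IsHeat β t (B u) w ∧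
    BENorm β α ι w ≤
      ENNReal.ofReal (C₂ * t ^ ((α + ((p : ℝ) - 1) * a - σ) / β) * ∏ i, ‖u i‖)

/-- `K₁ = C₁ ∫₀¹ (1-τ)^{((p-1)a-σ)/β} τ^{-pα/β} dτ`. -/
def constK₁ (β a σ α : ℝ) (p : ℕ) (C₁ : ℝ) : ℝ :=
  ∫ τ in (0 : ℝ)..1,
    C₁ * (1 - τ) ^ ((((p : ℝ) - 1) * a - σ) / β) * τ ^ (-((p : ℝ) * α) / β)

/-- `K₂ = C₂ ∫₀¹ (1-τ)^{((p-1)a-σ+α)/β} τ^{-pα/β} dτ`. -/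
def constK₂ (β a σ α : ℝ) (p : ℕ) (C₂ : ℝ) : ℝ :=
  ∫ τ in (0 : ℝ)..1,
    C₂ * (1 - τ) ^ ((((p : ℝ) - 1) * a - σ + α) / β) * τ ^ (-((p : ℝ) * α) / β)

/-- `sup_{t>0} ‖u(t)‖_{BE^α} + sup_{t>0} t^{α/β} ‖u(t)‖_E`; only the values of `u` on `(0, ∞)`
matter. -/
def solNorm (β α : ℝ) (ι : E →L[𝕜] Distr n 𝕜) (u : ℝ → E) : ℝ≥0∞ :=
  (⨆ (t : ℝ) (_ : 0 < t), BENorm β α ι (ι (u t))) +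
    ⨆ (t : ℝ) (_ : 0 < t), ENNReal.ofReal (t ^ (α / β)) * ‖u t‖ₑ

/-- Strong (Bochner) measurability on `(0, ∞)` with respect to the norm of `BE^α`: almost everywhere
limit of `BE^α`-valued simple functions. -/
def StronglyMeasurableBE (β α : ℝ) (ι : E →L[𝕜] Distr n 𝕜) (u : ℝ → E) : Prop :=
  ∃ s : ℕ → SimpleFunc ℝ (Distr n 𝕜), (∀ k t, BENorm β α ι (s k t) < ∞) ∧
    ∀ᵐ t ∂(volume.restrict (Ioi (0 : ℝ))),
      Tendsto (fun k => BENorm β α ι (s k t - ι (u t))) atTop (𝓝 0)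

/-- `u` is a global mild solution with initial datum `u₀`: it belongs to
`L^∞((0, ∞); BE^α) ∩ {u : (0, ∞) → E | sup_{t>0} t^{α/β} ‖u(t)‖_E < ∞}` and
`u(t) = S_β(t) u₀ + ∫₀ᵗ S_β(t-τ) B(u(τ), …, u(τ)) dτ` for every `t > 0`,
the integral being a Bochner integral in `E`. -/
structure IsGlobalSolution (β α : ℝ) {p : ℕ} [NormedSpace ℝ E] (ι : E →L[𝕜] Distr n 𝕜)
    (B : MultilinearMap 𝕜 (fun _ : Fin p => E) (Distr n 𝕜)) (u₀ : Distr n 𝕜) (u : ℝ → E) :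
    Prop where
  finite : solNorm β α ι u < ∞
  measurable : StronglyMeasurableBE β α ι u
  duhamel : ∀ t, 0 < t → ∃ (y : E) (f : ℝ → E), IsHeat β t u₀ (ι y) ∧
    (∀ τ ∈ Ioo 0 t, IsHeat β (t - τ) (B fun _ => u τ) (ι (f τ))) ∧
    IntegrableOn f (Ioo 0 t) ∧ u t = y + ∫ τ in Ioo 0 t, f τ

end Spaces

end FracHeat

end

namespace FracHeat

open scoped ContDiff

section FourierAlgebra

variable {n : ℕ}

/-- `f` is the Fourier transform of an integrable function of `L¹`-norm at most `c`. -/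
def IsFourierL1 (c : ℝ) (f : Space n → ℂ) : Prop :=
  ∃ k : Lp (α := Space n) ℂ 1, ‖k‖ ≤ c ∧ ∀ ξ, 𝓕 (k : Space n → ℂ) ξ = f ξ

theorem isFourierL1_of_integrable {k : Space n → ℂ} (hk : Integrable k) :
    IsFourierL1 (∫ x, ‖k x‖) (𝓕 k) := by
  refine ⟨hk.toL1 k, (L1.norm_of_fun_eq_integral_norm hk).le, fun ξ => ?_⟩
  exact Real.fourier_congr_ae (Integrable.coeFn_toL1 hk) ξ

theorem IsFourierL1.mul {c d : ℝ} {f g : Space n → ℂ} (hf : IsFourierL1 c f)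
    (hg : IsFourierL1 d g) : IsFourierL1 (c * d) (fun ξ => f ξ * g ξ) := by
  obtain ⟨k, hk, hkf⟩ := hf
  obtain ⟨l, hl, hlg⟩ := hg
  have hki := L1.integrable_coeFn k
  have hli := L1.integrable_coeFn l
  set m : Space n → ℂ :=
    MeasureTheory.convolution (k : Space n → ℂ) l (ContinuousLinearMap.mul ℂ ℂ) volume with hm
  have hmi : Integrable m := hki.integrable_convolution _ hli
  obtain ⟨m', hm', hmm'⟩ := isFourierL1_of_integrable hmi
  refine ⟨m', hm'.trans ?_, fun ξ => ?_⟩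
  · have h1 : ∫ x, ‖m x‖ ≤ ∫ x, MeasureTheory.convolution (fun x => ‖k x‖) (fun x => ‖l x‖)
        (ContinuousLinearMap.mul ℝ ℝ) volume x := by
      refine integral_mono hmi.norm (hki.norm.integrable_convolution _ hli.norm) fun x => ?_
      refine (norm_integral_le_integral_norm _).trans (le_of_eq ?_)
      simp [MeasureTheory.convolution]
    refine h1.trans ?_
    rw [integral_convolution _ hki.norm hli.norm]
    simp only [ContinuousLinearMap.mul_apply', ← L1.norm_eq_integral_norm]
    have := norm_nonneg k
    gcongr
    exact (norm_nonneg k).trans hk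
  · rw [hmm', Real.fourier_mul_convolution_eq hki hli, hkf, hlg]

theorem IsFourierL1.hasSum {c : ℕ → ℝ} {f : ℕ → Space n → ℂ} {g : Space n → ℂ}
    (hc : Summable c) (hf : ∀ j, IsFourierL1 (c j) (f j))
    (hg : ∀ ξ, HasSum (fun j => f j ξ) (g ξ)) : IsFourierL1 (∑' j, c j) g := by
  choose k hk hkf using hf
  have hks : Summable fun j => ‖k j‖ := Summable.of_nonneg_of_le (fun _ => norm_nonneg _) hk hc
  have hs : Summable k := hks.of_norm
  refine ⟨∑' j, k j, (norm_tsum_le_tsum_norm hks).trans (hks.tsum_le_tsum hk hc), fun ξ => ?_⟩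
  have h1 : HasSum (fun j => Real.Lp.fourierTransformCLM (Space n) ℂ (k j))
      (Real.Lp.fourierTransformCLM (Space n) ℂ (∑' j, k j)) := hs.hasSum.mapL _
  have h2 := h1.mapL (BoundedContinuousFunction.evalCLM ℂ ξ)
  simp only [Real.Lp.fourierTransformCLM_apply, BoundedContinuousFunction.evalCLM_apply,
    Real.Lp.fourierTransform_apply, hkf] at h2
  exact h2.unique (hg ξ)

theorem IsFourierL1.const_mul {c : ℝ} {f : Space n → ℂ} (hf : IsFourierL1 c f) (r : ℂ) :
    IsFourierL1 (‖r‖ * c) (fun ξ => r * f ξ) := by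
  obtain ⟨k, hk, hkf⟩ := hf
  refine ⟨r • k, ?_, fun ξ => ?_⟩
  · rw [norm_smul]; gcongr
  · have h1 : Real.Lp.fourierTransformCLM (Space n) ℂ (r • k) ξ =
        r • Real.Lp.fourierTransformCLM (Space n) ℂ k ξ := by
      rw [map_smul]; rfl
    exact h1.trans (congrArg (r * ·) (hkf ξ))

theorem fourier_comp_inv_smul (k : Space n → ℂ) {r : ℝ} (hr : 0 < r) (ξ : Space n) :
    𝓕 (fun x => (((r ^ n)⁻¹ : ℝ) : ℂ) * k (r⁻¹ • x)) ξ = 𝓕 k (r • ξ) := by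
  rw [Real.fourier_eq, Real.fourier_eq]
  have := Measure.integral_comp_inv_smul_of_nonneg volume
    (fun v : Space n => Real.fourierChar (-inner ℝ v (r • ξ)) • k v) hr.le
  rw [finrank_euclideanSpace_fin] at this
  have hrn : (r ^ n : ℝ) ≠ 0 := by positivity
  rw [← inv_smul_eq_iff₀ hrn, ← integral_smul] at this
  rw [← this]
  congr 1
  ext v
  have h3 : (inner ℝ (r⁻¹ • v) (r • ξ) : ℝ) = inner ℝ v ξ := by
    rw [inner_smul_left, inner_smul_right]
    simp only [conj_trivial]
    field_simp
  rw [h3, Circle.smul_def, Circle.smul_def]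
  simp only [smul_eq_mul, Complex.real_smul]
  ring

theorem IsFourierL1.comp_smul {c : ℝ} {f : Space n → ℂ} (hf : IsFourierL1 c f) {r : ℝ}
    (hr : 0 < r) : IsFourierL1 c (fun ξ => f (r • ξ)) := by
  obtain ⟨k, hk, hkf⟩ := hf
  have hki := L1.integrable_coeFn k
  have hi : Integrable (fun x => (((r ^ n)⁻¹ : ℝ) : ℂ) * k (r⁻¹ • x)) :=
    (hki.comp_smul (inv_ne_zero hr.ne')).const_mul _
  obtain ⟨m, hm, hmf⟩ := isFourierL1_of_integrable hi
  refine ⟨m, hm.trans (le_trans (le_of_eq ?_) hk), fun ξ => ?_⟩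
  · have := Measure.integral_comp_inv_smul_of_nonneg volume
      (fun v : Space n => ‖k v‖) hr.le
    simp only [norm_mul, integral_const_mul, this, finrank_euclideanSpace_fin]
    rw [L1.norm_eq_integral_norm, Complex.norm_real, Real.norm_of_nonneg (by positivity)]
    have : (r ^ n : ℝ) ≠ 0 := by positivity
    simp only [smul_eq_mul]
    field_simp
  · rw [hmf, fourier_comp_inv_smul _ hr, hkf]

theorem exists_isFourierL1_schwartz (φ : 𝓢(Space n, ℂ)) : ∃ c, IsFourierL1 c φ := by
  have h := isFourierL1_of_integrable (𝓕⁻ φ : 𝓢(Space n, ℂ)).integrable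
  rw [← SchwartzMap.fourier_coe] at h
  rw [FourierTransform.fourier_fourierInv_eq] at h
  exact ⟨_, h⟩

/-- The algebra of Fourier transforms of integrable functions is stable by the exponential. -/
theorem IsFourierL1.exp_mul {c d : ℝ} {f g : Space n → ℂ} (hf : IsFourierL1 c f)
    (hg : IsFourierL1 d g) : ∃ C, IsFourierL1 C (fun ξ => Complex.exp (f ξ) * g ξ) := by
  have hpow : ∀ j : ℕ, IsFourierL1 (c ^ j * d) (fun ξ => f ξ ^ j * g ξ) := by
    intro j
    induction j with
    | zero => simpa using hg
    | succ j ih =>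
      have := hf.mul ih
      convert this using 1
      · ring
      · ext ξ; ring
  refine ⟨_, IsFourierL1.hasSum (c := fun j => ‖((j.factorial : ℂ)⁻¹)‖ * (c ^ j * d)) ?_
    (fun j => (hpow j).const_mul ((j.factorial : ℂ)⁻¹)) fun ξ => ?_⟩
  · have := (Real.summable_pow_div_factorial c).mul_right d
    refine this.congr fun j => ?_
    simp
    ring
  · have := (NormedSpace.expSeries_div_hasSum_exp (𝔸 := ℂ) (f ξ)).mul_right (g ξ)
    rw [← Complex.exp_eq_exp_ℂ] at this
    have e : (fun j : ℕ => (j.factorial : ℂ)⁻¹ * (f ξ ^ j * g ξ)) =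
        fun j => f ξ ^ j / (j.factorial : ℂ) * g ξ := by
      funext j; ring
    rw [e]
    exact this

theorem continuous_fourierInv {f : Space n → ℂ} (hf : Integrable f) : Continuous (𝓕⁻ f) := by
  rw [Real.fourierInv_eq_fourier_comp_neg]
  exact VectorFourier.fourierIntegral_continuous Real.continuous_fourierChar
    (innerSL ℝ).continuous₂ hf.comp_neg

/-- Fourier inversion almost everywhere. -/
theorem ae_eq_fourierInv_of_fourier_eq {k f : Space n → ℂ} (hki : Integrable k)
    (hkf : ∀ ξ, 𝓕 k ξ = f ξ) (hfi : Integrable f) : k =ᵐ[volume] 𝓕⁻ f := by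
  refine ae_eq_of_integral_contDiff_smul_eq hki.locallyIntegrable
    (continuous_fourierInv hfi).locallyIntegrable fun g hg hgs => ?_
  have hg₁ : HasCompactSupport (Complex.ofRealCLM ∘ g) := hgs.comp_left rfl
  have hg₂ : ContDiff ℝ ∞ (Complex.ofRealCLM ∘ g) := by fun_prop
  set φ : 𝓢(Space n, ℂ) := hg₁.toSchwartzMap hg₂ with hφ
  have hflip : ∀ (u : Space n → ℂ), Integrable u → ∀ ψ : 𝓢(Space n, ℂ),
      ∫ ξ, 𝓕 u ξ * ψ ξ = ∫ x, u x * 𝓕 (ψ : Space n → ℂ) x := by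
    intro u hu ψ
    have := VectorFourier.integral_fourierIntegral_smul_eq_flip (μ := volume) (ν := volume)
      (L := innerₗ (Space n)) (f := u) (g := ψ) Real.continuous_fourierChar
      (innerSL ℝ).continuous₂ hu ψ.integrable
    simp only [flip_innerₗ] at this
    exact this
  have hφ1 : ∀ x, (φ x : ℂ) = g x := fun x => rfl
  have e1 : ∫ x, g x • k x = ∫ x, f x * (𝓕⁻ φ : 𝓢(Space n, ℂ)) x := by
    have := hflip k hki (𝓕⁻ φ)
    rw [← SchwartzMap.fourier_coe] at this
    simp only [FourierTransform.fourier_fourierInv_eq, hkf, hφ1] at this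
    rw [this]
    congr 1; ext x; rw [Complex.real_smul]; ring
  have e2 : ∫ x, g x • (𝓕⁻ f) x = ∫ x, f x * (𝓕⁻ φ : 𝓢(Space n, ℂ)) x := by
    have h3 := hflip (fun x => f (-x)) hfi.comp_neg φ
    rw [← Real.fourierInv_eq_fourier_comp_neg, ← SchwartzMap.fourier_coe] at h3
    rw [← integral_neg_eq_self] at h3
    have h4 : ∀ x, (𝓕⁻ φ : 𝓢(Space n, ℂ)) x = (𝓕 φ : 𝓢(Space n, ℂ)) (-x) := by
      intro x
      rw [SchwartzMap.fourierInv_coe, SchwartzMap.fourier_coe, Real.fourierInv_eq_fourier_neg]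
    simp only [h4]
    rw [← integral_neg_eq_self (fun x => f (-x) * (𝓕 φ : 𝓢(Space n, ℂ)) x)] at h3
    simp only [neg_neg] at h3
    rw [← h3, ← integral_neg_eq_self]
    congr 1; ext x; rw [hφ1, Complex.real_smul]; ring
  rw [e1, e2]

/-- The inverse Fourier transform of an integrable element of the algebra is integrable. -/
theorem IsFourierL1.integrable_fourierInv {c : ℝ} {f : Space n → ℂ} (hf : IsFourierL1 c f)
    (hfi : Integrable f) : Integrable (𝓕⁻ f) := by
  obtain ⟨k, -, hkf⟩ := hf
  exact (L1.integrable_coeFn k).congr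
    (ae_eq_fourierInv_of_fourier_eq (L1.integrable_coeFn k) hkf hfi)

end FourierAlgebra

end FracHeat

namespace FracHeat

open scoped ContDiff

section Symbol

/-- The Gaussian `exp (-s² / 2)` as a Schwartz function. -/
noncomputable def gaussianSchwartz : 𝓢(ℝ, ℂ) where
  toFun s := Complex.ofRealCLM (Real.exp (-(s ^ 2 / 2)))
  smooth' := by fun_prop
  decay' k j := by
    have hsm : ContDiff ℝ ∞ (fun s : ℝ => Real.exp (-(s ^ 2 / 2))) := by fun_prop
    set P : Polynomial ℝ := Polynomial.X ^ k * (Polynomial.hermite j).map (Int.castRingHom ℝ)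
    have hb : ∃ C, ∀ s : ℝ, |P.eval s| * Real.exp (-(s ^ 2 / 2)) ≤ C := by
      induction P using Polynomial.induction_on' with
      | add p q hp hq =>
        obtain ⟨C, hC⟩ := hp
        obtain ⟨D, hD⟩ := hq
        refine ⟨C + D, fun s => ?_⟩
        rw [Polynomial.eval_add]
        have := mul_le_mul_of_nonneg_right (abs_add_le (p.eval s) (q.eval s))
          (Real.exp_pos (-(s ^ 2 / 2))).le
        linarith [hC s, hD s]
      | monomial i r =>
        refine ⟨|r| * (i.factorial * Real.exp (1 / 2)), fun s => ?_⟩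
        rw [Polynomial.eval_monomial, abs_mul, mul_assoc, abs_pow]
        refine mul_le_mul_of_nonneg_left ?_ (abs_nonneg r)
        have h1 := Real.pow_div_factorial_le_exp |s| (abs_nonneg s) i
        rw [div_le_iff₀ (by positivity)] at h1
        calc |s| ^ i * Real.exp (-(s ^ 2 / 2))
            ≤ Real.exp |s| * i.factorial * Real.exp (-(s ^ 2 / 2)) := by gcongr
          _ = i.factorial * Real.exp (|s| + -(s ^ 2 / 2)) := by rw [Real.exp_add]; ring
          _ ≤ i.factorial * Real.exp (1 / 2) := by
            gcongr
            nlinarith [sq_nonneg (|s| - 1), sq_abs s]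
    obtain ⟨C, hC⟩ := hb
    refine ⟨C, fun s => ?_⟩
    have h1 : ‖iteratedFDeriv ℝ j (fun s : ℝ => Complex.ofRealCLM (Real.exp (-(s ^ 2 / 2)))) s‖ =
        ‖iteratedFDeriv ℝ j (fun s : ℝ => Real.exp (-(s ^ 2 / 2))) s‖ :=
      LinearIsometry.norm_iteratedFDeriv_comp_left Complex.ofRealLI hsm.contDiffAt
        (by exact_mod_cast le_top)
    rw [h1, norm_iteratedFDeriv_eq_norm_iteratedDeriv, iteratedDeriv_eq_iterate,
      Polynomial.deriv_gaussian_eq_hermite_mul_gaussian]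
    refine le_trans (le_of_eq ?_) (hC s)
    simp [P, abs_mul, Polynomial.aeval_def, Polynomial.eval_map, mul_assoc]

theorem gaussianSchwartz_apply (s : ℝ) :
    gaussianSchwartz s = (Real.exp (-(s ^ 2 / 2)) : ℝ) := rfl

/-- A smooth cutoff on the line, equal to `1` near `[1/2, 1]` and to `0` near `0`. -/
noncomputable def lineCutoff : ContDiffBump (1 : ℝ) := ⟨1 / 2, 3 / 4, by norm_num, by norm_num⟩

variable {n : ℕ}

/-- The map `ξ ↦ 1 - (1 + |ξ|²)⁻¹`, a smooth substitute for `|ξ|²` with values in `[0, 1)`. -/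
noncomputable def saturate (ξ : Space n) : ℝ := 1 - (1 + ‖ξ‖ ^ 2) ^ (-1 : ℝ)

theorem saturate_eq (ξ : Space n) : saturate ξ = ‖ξ‖ ^ 2 / (1 + ‖ξ‖ ^ 2) := by
  have : (1 + ‖ξ‖ ^ 2) ≠ 0 := by positivity
  rw [saturate, Real.rpow_neg_one]
  field_simp
  ring

theorem saturate_hasTemperateGrowth : (saturate (n := n)).HasTemperateGrowth := by
  unfold saturate
  fun_prop

/-- A smooth cutoff vanishing near `0` and equal to `1` outside the unit ball. -/
noncomputable def farCutoff (ξ : Space n) : ℝ := lineCutoff (saturate ξ)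

theorem farCutoff_contDiff : ContDiff ℝ ∞ (farCutoff (n := n)) :=
  lineCutoff.contDiff.comp saturate_hasTemperateGrowth.1

theorem farCutoff_eq_one {ξ : Space n} (h : 1 ≤ ‖ξ‖) : farCutoff ξ = 1 := by
  refine lineCutoff.one_of_mem_closedBall ?_
  rw [Metric.mem_closedBall, Real.dist_eq, abs_le, saturate_eq]
  have h2 : 1 ≤ ‖ξ‖ ^ 2 := one_le_pow₀ h
  change -(1 / 2 : ℝ) ≤ _ ∧ _ ≤ (1 / 2 : ℝ)
  constructor
  · rw [neg_le_sub_iff_le_add, ← sub_le_iff_le_add, le_div_iff₀ (by positivity)]; linarith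
  · rw [sub_le_iff_le_add, div_le_iff₀ (by positivity)]; linarith

theorem farCutoff_eq_zero {ξ : Space n} (h : ‖ξ‖ ≤ 1 / 2) : farCutoff ξ = 0 := by
  refine lineCutoff.zero_of_le_dist ?_
  rw [Real.dist_eq, saturate_eq]
  have h2 : ‖ξ‖ ^ 2 ≤ 1 / 4 := by nlinarith [norm_nonneg ξ]
  change (3 / 4 : ℝ) ≤ _
  refine le_trans ?_ (neg_le_abs _)
  rw [neg_sub, le_sub_comm, div_le_iff₀ (by positivity)]
  linarith

theorem farCutoff_mem (ξ : Space n) : 0 ≤ farCutoff ξ ∧ farCutoff ξ ≤ 1 :=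
  ⟨lineCutoff.nonneg, lineCutoff.le_one⟩

/-- A smooth function of temperate growth, equal to `√2 |ξ|^(β/2)` outside the unit ball. -/
noncomputable def smoothSqrt (β : ℝ) (ξ : Space n) : ℝ :=
  Real.sqrt 2 * (1 + ‖ξ‖ ^ 2) ^ (β / 4) * (saturate ξ ^ (β / 4) * lineCutoff (saturate ξ))

theorem smoothSqrt_eq {β : ℝ} (ξ : Space n) :
    smoothSqrt β ξ = Real.sqrt 2 * ‖ξ‖ ^ (β / 2) * farCutoff ξ := by
  have h0 : (0 : ℝ) ≤ 1 + ‖ξ‖ ^ 2 := by positivity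
  have h1 : (1 + ‖ξ‖ ^ 2) ^ (β / 4) * saturate ξ ^ (β / 4) = ‖ξ‖ ^ (β / 2) := by
    rw [saturate_eq, ← Real.mul_rpow h0 (by positivity), mul_div_cancel₀ _ (by positivity),
      ← Real.rpow_natCast, ← Real.rpow_mul (norm_nonneg _)]
    congr 1; push_cast; ring
  rw [smoothSqrt, farCutoff, ← h1]
  ring

theorem smoothSqrt_hasTemperateGrowth (β : ℝ) :
    (smoothSqrt (n := n) β).HasTemperateGrowth := by
  have h1 : (fun y : ℝ => y ^ (β / 4) * lineCutoff y).HasTemperateGrowth := by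
    refine HasCompactSupport.hasTemperateGrowth ?_ ?_
    · exact lineCutoff.hasCompactSupport.mul_left
    · rw [contDiff_iff_contDiffAt]
      intro y
      by_cases hy : y = 0
      · have : (fun y : ℝ => y ^ (β / 4) * lineCutoff y) =ᶠ[𝓝 y] fun _ => 0 := by
          filter_upwards [Metric.ball_mem_nhds y (show (0 : ℝ) < 1 / 4 by norm_num)] with z hz
          rw [Metric.mem_ball, Real.dist_eq, hy, abs_lt] at hz
          rw [lineCutoff.zero_of_le_dist, mul_zero]
          rw [Real.dist_eq]
          change (3 / 4 : ℝ) ≤ _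
          refine le_trans ?_ (neg_le_abs _)
          linarith [hz.2]
        exact contDiffAt_const.congr_of_eventuallyEq this
      · exact (Real.contDiffAt_rpow_const_of_ne hy).mul lineCutoff.contDiffAt
  have h2 : (fun ξ : Space n => Real.sqrt 2 * (1 + ‖ξ‖ ^ 2) ^ (β / 4)).HasTemperateGrowth := by
    fun_prop
  exact h2.mul (h1.comp saturate_hasTemperateGrowth)

theorem smoothSqrt_proper {β : ℝ} (hβ : 0 < β) :
    ∃ (k : ℕ) (C : ℝ), ∀ ξ : Space n, ‖ξ‖ ≤ C * (1 + ‖smoothSqrt β ξ‖) ^ k := by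
  obtain ⟨k, hk⟩ := exists_nat_ge (2 / β)
  refine ⟨k, 1, fun ξ => ?_⟩
  rw [one_mul]
  rcases le_total 1 ‖ξ‖ with h | h
  · rw [smoothSqrt_eq, farCutoff_eq_one h, mul_one]
    have h0 := norm_nonneg ξ
    have h1 : (‖ξ‖ ^ (β / 2)) ^ (2 / β) = ‖ξ‖ := by
      rw [← Real.rpow_mul h0]
      have : β / 2 * (2 / β) = 1 := by field_simp
      rw [this, Real.rpow_one]
    have h2 : ‖ξ‖ ^ (β / 2) ≤ 1 + ‖Real.sqrt 2 * ‖ξ‖ ^ (β / 2)‖ := by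
      rw [Real.norm_of_nonneg (by positivity)]
      have h3 : 1 ≤ Real.sqrt 2 := Real.one_le_sqrt.2 (by norm_num)
      nlinarith [Real.rpow_nonneg h0 (β / 2)]
    calc ‖ξ‖ = (‖ξ‖ ^ (β / 2)) ^ (2 / β) := h1.symm
      _ ≤ (‖ξ‖ ^ (β / 2)) ^ (k : ℝ) :=
          Real.rpow_le_rpow_of_exponent_le (Real.one_le_rpow h (by positivity)) hk
      _ = (‖ξ‖ ^ (β / 2)) ^ k := Real.rpow_natCast _ _
      _ ≤ _ := by gcongr
  · exact h.trans (one_le_pow₀ (by linarith [norm_nonneg (smoothSqrt β ξ)]))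

/-- The part of `|ξ|^β` that is singular at the origin. -/
noncomputable def nearPart (β : ℝ) (ξ : Space n) : ℝ := ‖ξ‖ ^ β * (1 - farCutoff ξ ^ 2)

/-- A dyadic piece of `nearPart`. -/
noncomputable def dyadicPiece (β : ℝ) (ξ : Space n) : ℝ :=
  ‖ξ‖ ^ β * (farCutoff ((2 : ℝ) • ξ) ^ 2 - farCutoff ξ ^ 2)

theorem dyadicPiece_hasCompactSupport (β : ℝ) :
    HasCompactSupport (dyadicPiece (n := n) β) := by
  refine HasCompactSupport.intro (isCompact_closedBall (0 : Space n) 1) fun ξ hξ => ?_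
  rw [Metric.mem_closedBall, dist_zero_right, not_le] at hξ
  have : 1 ≤ ‖(2 : ℝ) • ξ‖ := by rw [norm_smul, Real.norm_two]; linarith
  rw [dyadicPiece, farCutoff_eq_one hξ.le, farCutoff_eq_one this, sub_self, mul_zero]

theorem dyadicPiece_contDiff (β : ℝ) : ContDiff ℝ ∞ (dyadicPiece (n := n) β) := by
  rw [contDiff_iff_contDiffAt]
  intro ξ
  by_cases hξ : ξ = 0
  · have : dyadicPiece (n := n) β =ᶠ[𝓝 ξ] fun _ => 0 := by
      filter_upwards [Metric.ball_mem_nhds ξ (show (0 : ℝ) < 1 / 4 by norm_num)] with z hz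
      rw [Metric.mem_ball, hξ, dist_zero_right] at hz
      have : ‖(2 : ℝ) • z‖ ≤ 1 / 2 := by rw [norm_smul, Real.norm_two]; linarith
      rw [dyadicPiece, farCutoff_eq_zero this, farCutoff_eq_zero (by linarith), sub_self, mul_zero]
    exact contDiffAt_const.congr_of_eventuallyEq this
  · have h1 : ContDiffAt ℝ ∞ (fun ξ : Space n => ‖ξ‖ ^ β) ξ :=
      ContDiffAt.rpow_const_of_ne (contDiffAt_norm ℝ hξ) (norm_ne_zero_iff.2 hξ)
    have h2 : ContDiff ℝ ∞ (fun ξ : Space n => farCutoff ((2 : ℝ) • ξ)) :=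
      farCutoff_contDiff.comp (contDiff_const_smul _)
    exact h1.mul ((h2.pow 2).sub (farCutoff_contDiff.pow 2)).contDiffAt

theorem hasSum_dyadicPiece {β : ℝ} (hβ : 0 < β) (ξ : Space n) :
    HasSum (fun j : ℕ => ((2 : ℝ) ^ (-β)) ^ j * dyadicPiece β ((2 : ℝ) ^ j • ξ))
      (nearPart β ξ) := by
  have hterm : ∀ j : ℕ, ((2 : ℝ) ^ (-β)) ^ j * dyadicPiece β ((2 : ℝ) ^ j • ξ) =
      ‖ξ‖ ^ β * (farCutoff ((2 : ℝ) ^ (j + 1) • ξ) ^ 2 - farCutoff ((2 : ℝ) ^ j • ξ) ^ 2) := by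
    intro j
    have h2 : ‖(2 : ℝ) ^ j • ξ‖ ^ β = ((2 : ℝ) ^ β) ^ j * ‖ξ‖ ^ β := by
      rw [norm_smul, norm_pow, Real.norm_two, Real.mul_rpow (by positivity) (norm_nonneg _),
        ← Real.rpow_natCast, ← Real.rpow_natCast, ← Real.rpow_mul (by norm_num),
        ← Real.rpow_mul (by norm_num), mul_comm (j : ℝ)]
    have h3 : ((2 : ℝ) ^ (-β)) ^ j * ((2 : ℝ) ^ β) ^ j = 1 := by
      rw [← mul_pow, ← Real.rpow_add (by norm_num), neg_add_cancel, Real.rpow_zero, one_pow]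
    rw [dyadicPiece, h2, smul_smul, ← pow_succ', ← mul_assoc, ← mul_assoc, h3, one_mul]
  simp only [hterm]
  rcases eq_or_ne ξ 0 with rfl | hξ
  · simp [nearPart, Real.zero_rpow hβ.ne']
  obtain ⟨N, hN⟩ := pow_unbounded_of_one_lt (‖ξ‖⁻¹) (one_lt_two : (1 : ℝ) < 2)
  have hfar : ∀ j, N ≤ j → farCutoff ((2 : ℝ) ^ j • ξ) = 1 := by
    intro j hj
    refine farCutoff_eq_one ?_
    rw [norm_smul, norm_pow, Real.norm_two]
    have h4 : (2 : ℝ) ^ N ≤ 2 ^ j := pow_le_pow_right₀ (by norm_num) hj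
    have h5 := norm_pos_iff.2 hξ
    calc (1 : ℝ) = ‖ξ‖⁻¹ * ‖ξ‖ := by field_simp
      _ ≤ 2 ^ j * ‖ξ‖ := by gcongr; linarith
  have hs := hasSum_sum_of_ne_finset_zero (L := SummationFilter.unconditional ℕ)
    (s := Finset.range N) (f := fun j : ℕ => ‖ξ‖ ^ β *
      (farCutoff ((2 : ℝ) ^ (j + 1) • ξ) ^ 2 - farCutoff ((2 : ℝ) ^ j • ξ) ^ 2)) fun j hj => by
    rw [Finset.mem_range, not_lt] at hj
    rw [hfar j hj, hfar (j + 1) (by omega), sub_self, mul_zero]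
  rw [← Finset.mul_sum, Finset.sum_range_sub (fun j : ℕ => farCutoff ((2 : ℝ) ^ j • ξ) ^ 2),
    hfar N le_rfl] at hs
  simpa [nearPart] using hs

theorem exists_isFourierL1_nearPart {β : ℝ} (hβ : 0 < β) :
    ∃ c, IsFourierL1 c (fun ξ : Space n => ((nearPart β ξ : ℝ) : ℂ)) := by
  obtain ⟨c, hc⟩ := exists_isFourierL1_schwartz
    (HasCompactSupport.toSchwartzMap (f := fun ξ : Space n => Complex.ofRealCLM (dyadicPiece β ξ))
      ((dyadicPiece_hasCompactSupport β).comp_left (map_zero _))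
      (Complex.ofRealCLM.contDiff.comp (dyadicPiece_contDiff β)))
  have hr : (2 : ℝ) ^ (-β) < 1 := Real.rpow_lt_one_of_one_lt_of_neg (by norm_num) (by linarith)
  refine ⟨_, IsFourierL1.hasSum (c := fun j => ‖((((2 : ℝ) ^ (-β)) ^ j : ℝ) : ℂ)‖ * c) ?_
    (fun j => (hc.comp_smul (show (0 : ℝ) < 2 ^ j by positivity)).const_mul _) fun ξ => ?_⟩
  · refine Summable.mul_right _ ?_
    refine (summable_geometric_of_lt_one (by positivity) hr).congr fun j => ?_
    rw [Complex.norm_real, Real.norm_of_nonneg (by positivity)]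
  · have := (hasSum_dyadicPiece hβ ξ).mapL Complex.ofRealCLM
    simpa using this

theorem exp_neg_rpow_eq {β : ℝ} (ξ : Space n) :
    Real.exp (-‖ξ‖ ^ β) = Real.exp (-nearPart β ξ) * Real.exp (-(smoothSqrt β ξ ^ 2 / 2)) := by
  rw [← Real.exp_add]
  congr 1
  rw [smoothSqrt_eq, nearPart, mul_pow, mul_pow, Real.sq_sqrt (by norm_num),
    ← Real.rpow_natCast (‖ξ‖ ^ (β / 2)), ← Real.rpow_mul (norm_nonneg _)]
  have : β / 2 * (2 : ℕ) = β := by push_cast; ring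
  rw [this]
  ring

theorem exists_isFourierL1_exp_neg_rpow {β : ℝ} (hβ : 0 < β) :
    ∃ c, IsFourierL1 c (fun ξ : Space n => ((Real.exp (-‖ξ‖ ^ β) : ℝ) : ℂ)) := by
  obtain ⟨c, hc⟩ := exists_isFourierL1_nearPart (n := n) hβ
  obtain ⟨d, hd⟩ := exists_isFourierL1_schwartz (SchwartzMap.compCLM ℝ
    (smoothSqrt_hasTemperateGrowth (n := n) β) (smoothSqrt_proper hβ) gaussianSchwartz)
  obtain ⟨C, hC⟩ := (hc.const_mul (-1)).exp_mul hd
  refine ⟨C, ?_⟩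
  convert hC using 1
  ext ξ
  rw [SchwartzMap.compCLM_apply, Function.comp_apply, gaussianSchwartz_apply, exp_neg_rpow_eq]
  push_cast
  ring_nf

theorem integrable_exp_neg_rpow {β : ℝ} (hβ : 0 < β) :
    Integrable (fun ξ : Space n => Real.exp (-‖ξ‖ ^ β)) := by
  have h1 := (SchwartzMap.compCLM ℝ (smoothSqrt_hasTemperateGrowth (n := n) β)
    (smoothSqrt_proper hβ) gaussianSchwartz).integrable (μ := volume)
  have hc : Continuous (fun ξ : Space n => Real.exp (-‖ξ‖ ^ β)) := by
    have : Continuous (fun ξ : Space n => ‖ξ‖ ^ β) :=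
      continuous_norm.rpow_const fun _ => Or.inr hβ.le
    fun_prop
  refine h1.mono hc.aestronglyMeasurable (Eventually.of_forall fun ξ => ?_)
  rw [SchwartzMap.compCLM_apply, Function.comp_apply, gaussianSchwartz_apply, exp_neg_rpow_eq,
    Complex.norm_real, norm_mul]
  refine mul_le_of_le_one_left (norm_nonneg _) ?_
  rw [Real.norm_of_nonneg (Real.exp_pos _).le, Real.exp_le_one_iff, neg_nonpos]
  have := farCutoff_mem ξ
  refine mul_nonneg (by positivity) (sub_nonneg.2 (pow_le_one₀ this.1 this.2))

end Symbol

end FracHeat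

namespace FracHeat

open scoped ContDiff

section Kernel

variable {n : ℕ} {β : ℝ}

/-- The symbol `exp (-t |ξ|^β)` of `S_β(t)`. -/
noncomputable def heatSymbol (β t : ℝ) (ξ : Space n) : ℂ := ((Real.exp (-t * ‖ξ‖ ^ β) : ℝ) : ℂ)

theorem fourierInv_heatSymbol_smul (t : ℝ) {r : ℝ} (hr : 0 < r) (x : Space n) :
    𝓕⁻ (heatSymbol (n := n) β (r ^ (-β) * t)) x = (r ^ n : ℝ) * 𝓕⁻ (heatSymbol β t) (r • x) := by
  rw [Real.fourierInv_eq, Real.fourierInv_eq]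
  have := Measure.integral_comp_smul_of_nonneg volume
    (fun v : Space n => Real.fourierChar (inner ℝ v x) • heatSymbol β (r ^ (-β) * t) v) r
    (hR := hr.le)
  rw [finrank_euclideanSpace_fin] at this
  have hrn : (r ^ n : ℝ) ≠ 0 := by positivity
  rw [← inv_smul_eq_iff₀ (inv_ne_zero hrn), inv_inv, Complex.real_smul] at this
  rw [← this]
  have hsym : ∀ v : Space n, heatSymbol β (r ^ (-β) * t) (r • v) = heatSymbol β t v := by
    intro v
    have : r ^ β ≠ 0 := (Real.rpow_pos_of_pos hr β).ne'
    simp only [heatSymbol, norm_smul, Real.norm_of_nonneg hr.le,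
      Real.mul_rpow hr.le (norm_nonneg _), Real.rpow_neg hr.le]
    congr 2
    field_simp
  simp only [hsym, inner_smul_left, inner_smul_right, conj_trivial]

theorem kernel_smul (t : ℝ) {r : ℝ} (hr : 0 < r) (x : Space n) :
    kernel β (r ^ (-β) * t) x = r ^ n * kernel β t (r • x) := by
  have := congrArg Complex.re (fourierInv_heatSymbol_smul (β := β) t hr x)
  rw [Complex.re_ofReal_mul] at this
  exact this

theorem ofReal_kernel (t : ℝ) (x : Space n) :
    ((kernel β t x : ℝ) : ℂ) = 𝓕⁻ (heatSymbol β t) x := by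
  change ((Complex.re (𝓕⁻ (heatSymbol β t) x) : ℝ) : ℂ) = _
  rw [← Complex.conj_eq_iff_re, Real.fourierInv_eq, ← integral_conj,
    ← integral_neg_eq_self]
  congr 1
  ext v
  rw [Circle.smul_def, Circle.smul_def, smul_eq_mul, smul_eq_mul, map_mul, inner_neg_left,
    AddChar.map_neg_eq_inv, Circle.coe_inv_eq_conj, Complex.conj_conj, heatSymbol, heatSymbol,
    norm_neg, Complex.conj_ofReal]

theorem rpow_inv_neg {t : ℝ} (hβ : 0 < β) (ht : 0 < t) : (t ^ (-β⁻¹)) ^ (-β) = t := by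
  rw [← Real.rpow_mul ht.le]
  have : -β⁻¹ * -β = 1 := by field_simp
  rw [this, Real.rpow_one]

theorem kernel_eq_kernel_one (hβ : 0 < β) {t : ℝ} (ht : 0 < t) (x : Space n) :
    kernel β t x = (t ^ (-β⁻¹)) ^ n * kernel β 1 (t ^ (-β⁻¹) • x) := by
  have := kernel_smul (β := β) 1 (Real.rpow_pos_of_pos ht (-β⁻¹)) x
  rwa [rpow_inv_neg hβ ht, mul_one] at this

theorem heatSymbol_one (ξ : Space n) : heatSymbol β 1 ξ = ((Real.exp (-‖ξ‖ ^ β) : ℝ) : ℂ) := by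
  rw [heatSymbol]; congr 3; ring

theorem integrable_heatSymbol_one (hβ : 0 < β) : Integrable (heatSymbol (n := n) β 1) := by
  simp only [funext heatSymbol_one]
  exact (integrable_exp_neg_rpow hβ).ofReal

theorem heatSymbol_eq {t : ℝ} (hβ : 0 < β) (ht : 0 < t) (ξ : Space n) :
    heatSymbol β t ξ = heatSymbol β 1 (t ^ β⁻¹ • ξ) := by
  rw [heatSymbol, heatSymbol, norm_smul, Real.norm_of_nonneg (by positivity),
    Real.mul_rpow (by positivity) (norm_nonneg _), ← Real.rpow_mul ht.le,
    inv_mul_cancel₀ hβ.ne', Real.rpow_one, neg_mul, neg_mul, one_mul]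

theorem integrable_heatSymbol (hβ : 0 < β) {t : ℝ} (ht : 0 < t) :
    Integrable (heatSymbol (n := n) β t) := by
  simp only [funext (heatSymbol_eq hβ ht)]
  exact (integrable_heatSymbol_one hβ).comp_smul (by positivity)

theorem continuous_heatSymbol (hβ : 0 < β) (t : ℝ) : Continuous (heatSymbol (n := n) β t) := by
  have : Continuous (fun ξ : Space n => ‖ξ‖ ^ β) :=
    continuous_norm.rpow_const fun _ => Or.inr hβ.le
  unfold heatSymbol
  fun_prop

theorem continuous_kernel (hβ : 0 < β) {t : ℝ} (ht : 0 < t) :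
    Continuous (kernel (n := n) β t) :=
  Complex.continuous_re.comp (continuous_fourierInv (integrable_heatSymbol hβ ht))

theorem integrable_kernel (hβ : 0 < β) {t : ℝ} (ht : 0 < t) :
    Integrable (kernel (n := n) β t) := by
  have h1 : Integrable (kernel (n := n) β 1) := by
    obtain ⟨c, hc⟩ := exists_isFourierL1_exp_neg_rpow (n := n) hβ
    simp only [← heatSymbol_one] at hc
    exact (hc.integrable_fourierInv (integrable_heatSymbol_one hβ)).re
  rw [funext (kernel_eq_kernel_one hβ ht)]
  exact (h1.comp_smul (by positivity)).const_mul _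

theorem fourier_kernel (hβ : 0 < β) {t : ℝ} (ht : 0 < t) (ξ : Space n) :
    𝓕 (fun x : Space n => ((kernel β t x : ℝ) : ℂ)) ξ = heatSymbol β t ξ := by
  have hi : Integrable (𝓕⁻ (heatSymbol (n := n) β t)) := by
    rw [← funext (ofReal_kernel t)]
    exact (integrable_kernel hβ ht).ofReal
  have h2 : Integrable (𝓕 (heatSymbol (n := n) β t)) := by
    refine hi.comp_neg.congr (Eventually.of_forall fun x => ?_)
    simp only [Real.fourierInv_eq_fourier_neg, neg_neg]
  rw [funext (ofReal_kernel t), (continuous_heatSymbol hβ t).fourier_fourierInv_eq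
    (integrable_heatSymbol hβ ht) h2]

/-- The semigroup law for the kernels. -/
theorem convolution_kernel (hβ : 0 < β) {s t : ℝ} (hs : 0 < s) (ht : 0 < t) :
    MeasureTheory.convolution (kernel (n := n) β s) (kernel β t)
      (ContinuousLinearMap.mul ℝ ℝ) volume =ᵐ[volume] kernel β (s + t) := by
  have hsi := integrable_kernel (n := n) hβ hs
  have hti := integrable_kernel (n := n) hβ ht
  have hc : ∀ x, ((MeasureTheory.convolution (kernel (n := n) β s) (kernel β t)
      (ContinuousLinearMap.mul ℝ ℝ) volume x : ℝ) : ℂ) =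
      MeasureTheory.convolution (fun x => ((kernel (n := n) β s x : ℝ) : ℂ))
        (fun x => ((kernel β t x : ℝ) : ℂ)) (ContinuousLinearMap.mul ℂ ℂ) volume x := by
    intro x
    rw [MeasureTheory.convolution, MeasureTheory.convolution]
    refine (integral_ofReal (𝕜 := ℂ)).symm.trans ?_
    simp
  have hi := hsi.ofReal.integrable_convolution (𝕜 := ℂ) (ContinuousLinearMap.mul ℂ ℂ)
    (hti.ofReal (𝕜 := ℂ))
  have h1 := ae_eq_fourierInv_of_fourier_eq hi (f := heatSymbol β (s + t)) (fun ξ => by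
    have h := Real.fourier_mul_convolution_eq (R := ℂ) hsi.ofReal hti.ofReal ξ
    refine h.trans ?_
    have e1 := fourier_kernel hβ hs ξ
    have e2 := fourier_kernel hβ ht ξ
    refine (congrArg₂ (· * ·) e1 e2).trans ?_
    simp only [heatSymbol]
    rw [← Complex.ofReal_mul, ← Real.exp_add]
    congr 2; ring) (integrable_heatSymbol hβ (add_pos hs ht))
  filter_upwards [h1] with x hx
  have h3 := (hc x).trans (hx.trans (ofReal_kernel (s + t) x).symm)
  exact_mod_cast h3

theorem integral_abs_kernel (hβ : 0 < β) {t : ℝ} (ht : 0 < t) :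
    ∫ x : Space n, |kernel β t x| = ∫ x : Space n, |kernel β 1 x| := by
  have hr : 0 < t ^ (-β⁻¹) := by positivity
  have := Measure.integral_comp_smul_of_nonneg volume
    (fun v : Space n => |kernel β 1 v|) (t ^ (-β⁻¹)) (hR := hr.le)
  simp only [kernel_eq_kernel_one hβ ht, abs_mul, integral_const_mul, this,
    finrank_euclideanSpace_fin, abs_of_pos (pow_pos hr n), smul_eq_mul]
  have h2 := (pow_pos hr n).ne'
  field_simp

theorem continuousAt_kernel_left (hβ : 0 < β) {s : ℝ} (hs : 0 < s) (x : Space n) :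
    ContinuousAt (fun t => kernel β t x) s := by
  have h1 : (fun t => kernel β t x) =ᶠ[𝓝 s]
      fun t => (t ^ (-β⁻¹)) ^ n * kernel β 1 (t ^ (-β⁻¹) • x) := by
    filter_upwards [lt_mem_nhds hs] with t ht using kernel_eq_kernel_one hβ ht x
  refine ContinuousAt.congr ?_ h1.symm
  have h2 : ContinuousAt (fun t : ℝ => t ^ (-β⁻¹)) s :=
    Real.continuousAt_rpow_const _ _ (Or.inl hs.ne')
  refine (h2.pow n).mul ?_
  exact (continuous_kernel hβ one_pos).continuousAt.comp (h2.smul continuousAt_const)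

/-- The kernel depends continuously on `t > 0` in `L¹`. -/
theorem tendsto_integral_abs_kernel_sub (hβ : 0 < β) {s : ℝ} (hs : 0 < s) :
    Tendsto (fun t => ∫ x : Space n, |kernel β t x - kernel β s x|) (𝓝 s) (𝓝 0) := by
  have hsi := integrable_kernel (n := n) hβ hs
  have h1 : Tendsto (fun t => ∫ x : Space n, (|kernel β t x| - |kernel β t x - kernel β s x|))
      (𝓝 s) (𝓝 (∫ x : Space n, |kernel β s x|)) := by
    refine tendsto_integral_filter_of_dominated_convergence (fun x => |kernel β s x|) ?_ ?_
      hsi.abs ?_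
    · filter_upwards [lt_mem_nhds hs] with t ht
      have hti := integrable_kernel (n := n) hβ ht
      exact (hti.abs.sub (hti.sub hsi).abs).aestronglyMeasurable
    · refine Eventually.of_forall fun t => Eventually.of_forall fun x => ?_
      rw [Real.norm_eq_abs]
      refine (abs_abs_sub_abs_le _ _).trans ?_
      rw [sub_sub_cancel]
    · refine Eventually.of_forall fun x => ?_
      have h2 : Tendsto (fun t => kernel β t x) (𝓝 s) (𝓝 (kernel β s x)) :=
        continuousAt_kernel_left hβ hs x
      have h3 := h2.abs.sub (h2.sub_const (kernel β s x)).abs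
      simpa using h3
  have h4 : (fun t => ∫ x : Space n, |kernel β t x - kernel β s x|) =ᶠ[𝓝 s]
      fun t => (∫ x : Space n, |kernel β s x|) -
        ∫ x : Space n, (|kernel β t x| - |kernel β t x - kernel β s x|) := by
    filter_upwards [lt_mem_nhds hs] with t ht
    have hti := integrable_kernel (n := n) hβ ht
    have hd : Integrable (fun x : Space n => |kernel β t x - kernel β s x|) := (hti.sub hsi).abs
    rw [integral_sub hti.abs hd, integral_abs_kernel hβ ht,
      integral_abs_kernel hβ hs, sub_sub_cancel]
  refine Tendsto.congr' h4.symm ?_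
  simpa using h1.const_sub (∫ x : Space n, |kernel β s x|)

end Kernel

end FracHeat

namespace FracHeat

section Translations

variable {𝕜 : Type*} [RCLike 𝕜] {n : ℕ}

theorem exists_seminorm_compSubConst_sub_le (ψ : 𝓢(Space n, 𝕜)) (k l : ℕ) :
    ∃ C : ℝ, 0 ≤ C ∧ ∀ b : Space n, ‖b‖ ≤ 1 →
      SchwartzMap.seminorm 𝕜 k l (SchwartzMap.compSubConstCLM 𝕜 b ψ - ψ) ≤ C * ‖b‖ := by
  set D : ℝ := 2 ^ k * ((Finset.Iic (k, l + 1)).sup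
    (schwartzSeminormFamily 𝕜 (Space n) 𝕜)) ψ with hD
  have hD0 : 0 ≤ D := mul_nonneg (by positivity) (apply_nonneg _ _)
  have hdec : ∀ z : Space n, (1 + ‖z‖) ^ k * ‖iteratedFDeriv ℝ (l + 1) ψ z‖ ≤ D := fun z =>
    SchwartzMap.one_add_le_sup_seminorm_apply (m := (k, l + 1)) (k := k) (n := l + 1) le_rfl le_rfl
      ψ z
  refine ⟨2 ^ k * D, by positivity, fun b hb => ?_⟩
  refine SchwartzMap.seminorm_le_bound 𝕜 k l _ (by positivity) fun x => ?_
  have h1 : iteratedFDeriv ℝ l (SchwartzMap.compSubConstCLM 𝕜 b ψ - ψ : 𝓢(Space n, 𝕜)) x =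
      iteratedFDeriv ℝ l ψ (x - b) - iteratedFDeriv ℝ l ψ x := by
    have e : ((SchwartzMap.compSubConstCLM 𝕜 b ψ - ψ : 𝓢(Space n, 𝕜)) : Space n → 𝕜) =
        (fun z => ψ (z - b)) - ψ := rfl
    have hs1 : ContDiff ℝ l (fun z => ψ (z - b)) :=
      (ψ.smooth l).comp (contDiff_id.sub contDiff_const)
    rw [e, iteratedFDeriv_sub hs1 (ψ.smooth l), Pi.sub_apply, iteratedFDeriv_comp_sub]
  have hx : 0 < (1 + ‖x‖) ^ k := by positivity
  have h2 : ‖iteratedFDeriv ℝ l ψ (x - b) - iteratedFDeriv ℝ l ψ x‖ ≤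
      (2 ^ k * D / (1 + ‖x‖) ^ k) * ‖(x - b) - x‖ := by
    refine (convex_closedBall x 1).norm_image_sub_le_of_norm_fderiv_le (𝕜 := ℝ) ?_ ?_ ?_ ?_
    · intro z _
      have := (ψ.smooth (l + 1 : ℕ)).differentiable_iteratedFDeriv (m := l)
        (by exact_mod_cast Nat.lt_succ_self l)
      exact this z
    · intro z hz
      rw [norm_fderiv_iteratedFDeriv, le_div_iff₀ hx]
      have hz' : ‖x‖ ≤ ‖z‖ + 1 := by
        rw [Metric.mem_closedBall, dist_eq_norm] at hz
        have := norm_sub_norm_le x z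
        rw [norm_sub_rev] at this
        linarith
      have h3 : (1 + ‖x‖) ^ k ≤ 2 ^ k * (1 + ‖z‖) ^ k := by
        rw [← mul_pow]
        exact pow_le_pow_left₀ (by positivity) (by linarith [norm_nonneg z]) k
      calc ‖iteratedFDeriv ℝ (l + 1) ψ z‖ * (1 + ‖x‖) ^ k
          ≤ ‖iteratedFDeriv ℝ (l + 1) ψ z‖ * (2 ^ k * (1 + ‖z‖) ^ k) := by gcongr
        _ = 2 ^ k * ((1 + ‖z‖) ^ k * ‖iteratedFDeriv ℝ (l + 1) ψ z‖) := by ring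
        _ ≤ 2 ^ k * D := by gcongr; exact hdec z
    · simp
    · simpa using hb
  rw [h1]
  have h4 : ‖x‖ ^ k ≤ (1 + ‖x‖) ^ k := by gcongr; linarith
  rw [show x - b - x = -b by abel, norm_neg] at h2
  calc _ ≤ (1 + ‖x‖) ^ k * ((2 ^ k * D / (1 + ‖x‖) ^ k) * ‖b‖) := by gcongr
    _ = 2 ^ k * D * ‖b‖ := by field_simp

/-- Translation is continuous in the Schwartz space. -/
theorem continuous_compSubConst (φ : 𝓢(Space n, 𝕜)) :
    Continuous fun y : Space n => SchwartzMap.compSubConstCLM 𝕜 y φ := by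
  rw [continuous_iff_continuousAt]
  intro a
  rw [ContinuousAt, (schwartz_withSeminorms 𝕜 (Space n) 𝕜).tendsto_nhds]
  rintro ⟨k, l⟩ ε hε
  obtain ⟨C, hC0, hC⟩ := exists_seminorm_compSubConst_sub_le
    (SchwartzMap.compSubConstCLM 𝕜 a φ) k l
  have hδ : 0 < min 1 (ε / (C + 1)) := by positivity
  filter_upwards [Metric.ball_mem_nhds a hδ] with y hy
  rw [Metric.mem_ball, dist_eq_norm, lt_min_iff] at hy
  have h1 := hC (y - a) hy.1.le
  rw [SchwartzMap.compSubConstCLM_comp, add_sub_cancel] at h1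
  refine h1.trans_lt ?_
  have h2 := hy.2
  rw [lt_div_iff₀ (by positivity)] at h2
  nlinarith [norm_nonneg (y - a)]

theorem translate_apply (y : Space n) (u : Distr n 𝕜) (φ : 𝓢(Space n, 𝕜)) :
    translate y u φ = u (SchwartzMap.compSubConstCLM 𝕜 (-y) φ) := rfl

theorem continuous_translate (u : Distr n 𝕜) (φ : 𝓢(Space n, 𝕜)) :
    Continuous fun y => translate y u φ :=
  (map_continuous u).comp ((continuous_compSubConst φ).comp continuous_neg)

theorem translate_compSubConst (y z : Space n) (u : Distr n 𝕜) (φ : 𝓢(Space n, 𝕜)) :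
    translate y u (SchwartzMap.compSubConstCLM 𝕜 (-z) φ) = translate (y + z) u φ := by
  rw [translate_apply, translate_apply, SchwartzMap.compSubConstCLM_comp, neg_add_rev]

theorem translate_add_right (y : Space n) (u v : Distr n 𝕜) (φ : 𝓢(Space n, 𝕜)) :
    translate y (u + v) φ = translate y u φ + translate y v φ := rfl

theorem translate_smul_right (y : Space n) (c : 𝕜) (u : Distr n 𝕜) (φ : 𝓢(Space n, 𝕜)) :
    translate y (c • u) φ = c * translate y u φ := rfl

theorem IsBoundedDistr.integrable {u : Distr n 𝕜} (hu : IsBoundedDistr u) {k : Space n → ℝ}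
    (hk : Integrable k) (φ : 𝓢(Space n, 𝕜)) : Integrable fun y => k y • translate y u φ := by
  obtain ⟨C, hC⟩ := hu φ
  refine (hk.norm.mul_const C).mono'
    (hk.aestronglyMeasurable.smul (continuous_translate u φ).aestronglyMeasurable)
    (Eventually.of_forall fun y => ?_)
  rw [norm_smul]
  gcongr
  exact hC y

theorem IsConv.unique {k : Space n → ℝ} {u v w : Distr n 𝕜} (h : IsConv k u v)
    (h' : IsConv k u w) : v = w := by
  ext φ
  rw [h.2, h'.2]

theorem IsConv.congr_ae {k l : Space n → ℝ} {u v : Distr n 𝕜} (h : IsConv k u v)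
    (hkl : k =ᵐ[volume] l) : IsConv l u v := by
  refine ⟨h.1, fun φ => ?_⟩
  rw [h.2]
  refine integral_congr_ae ?_
  filter_upwards [hkl] with y hy
  rw [hy]

theorem IsConv.add {k : Space n → ℝ} (hk : Integrable k) {u v u' v' : Distr n 𝕜}
    (h : IsConv k u v) (h' : IsConv k u' v') : IsConv k (u + u') (v + v') := by
  refine ⟨fun φ => ?_, fun φ => ?_⟩
  · obtain ⟨C, hC⟩ := h.1 φ
    obtain ⟨D, hD⟩ := h'.1 φ
    exact ⟨C + D, fun y => (norm_add_le _ _).trans (add_le_add (hC y) (hD y))⟩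
  · change v φ + v' φ = _
    simp only [translate_add_right, smul_add]
    rw [integral_add (h.1.integrable hk φ) (h'.1.integrable hk φ), h.2, h'.2]

theorem IsConv.smul {k : Space n → ℝ} {u v : Distr n 𝕜} (h : IsConv k u v) (c : 𝕜) :
    IsConv k (c • u) (c • v) := by
  refine ⟨fun φ => ?_, fun φ => ?_⟩
  · obtain ⟨C, hC⟩ := h.1 φ
    refine ⟨‖c‖ * C, fun y => ?_⟩
    rw [translate_smul_right, norm_mul]
    gcongr
    exact hC y
  · change c * v φ = _
    simp only [translate_smul_right, ← mul_smul_comm]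
    rw [integral_const_mul, h.2]

theorem IsConv.sub {k : Space n → ℝ} (hk : Integrable k) {u v u' v' : Distr n 𝕜}
    (h : IsConv k u v) (h' : IsConv k u' v') : IsConv k (u - u') (v - v') := by
  have e : ∀ w : Distr n 𝕜, (-1 : 𝕜) • w = -w := fun w => by
    ext φ
    exact neg_one_mul (w φ)
  have := h.add hk (h'.smul (-1))
  rwa [e, e, ← sub_eq_add_neg, ← sub_eq_add_neg] at this

theorem IsConv.sub_left {k l : Space n → ℝ} (hk : Integrable k) (hl : Integrable l)
    {u v w : Distr n 𝕜} (h : IsConv k u v) (h' : IsConv l u w) :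
    IsConv (fun y => k y - l y) u (v - w) := by
  refine ⟨h.1, fun φ => ?_⟩
  change v φ - w φ = _
  simp only [sub_smul]
  rw [integral_sub (h.1.integrable hk φ) (h.1.integrable hl φ), h.2, h'.2]

/-- Associativity of the convolution. -/
theorem IsConv.comp {k l : Space n → ℝ} (hk : Integrable k) (hl : Integrable l)
    {u v w : Distr n 𝕜} (h : IsConv k u v) (h' : IsConv l v w) :
    IsConv (MeasureTheory.convolution l k (ContinuousLinearMap.mul ℝ ℝ) volume) u w := by
  refine ⟨h.1, fun φ => ?_⟩
  obtain ⟨C, hC⟩ := h.1 φ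
  have hint : Integrable (fun q : Space n × Space n =>
      (l q.2 * k (q.1 - q.2)) • translate q.1 u φ) (volume.prod volume) := by
    have h1 : Integrable (fun q : Space n × Space n => l q.2 * k (q.1 - q.2))
        (volume.prod volume) := hl.convolution_integrand (ContinuousLinearMap.mul ℝ ℝ) hk
    refine (h1.norm.mul_const C).mono' (h1.aestronglyMeasurable.smul
      ((continuous_translate u φ).comp continuous_fst).aestronglyMeasurable)
      (Eventually.of_forall fun q => ?_)
    rw [norm_smul]
    gcongr
    exact hC _
  have e1 : ∫ x, MeasureTheory.convolution l k (ContinuousLinearMap.mul ℝ ℝ) volume x •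
      translate x u φ = ∫ x, ∫ t, (l t * k (x - t)) • translate x u φ := by
    congr 1
    ext x
    rw [integral_smul_const]
    rfl
  rw [e1, integral_integral_swap hint, h'.2]
  congr 1
  ext t
  rw [translate_apply, h.2]
  simp only [translate_compSubConst, mul_smul]
  rw [integral_smul]
  congr 1
  rw [← integral_sub_right_eq_self _ t]
  simp

theorem dilate_apply {lam : ℝ} (hlam : 0 < lam) (u : Distr n 𝕜) (φ : 𝓢(Space n, 𝕜)) :
    dilate lam hlam u φ = (((lam ^ n)⁻¹ : ℝ) : 𝕜) *
      u (SchwartzMap.compCLMOfContinuousLinearEquiv 𝕜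
      (ContinuousLinearEquiv.smulLeft (M₁ := Space n) (R₁ := ℝ) (Units.mk0 lam hlam.ne')⁻¹) φ) :=
  rfl

theorem dilate_inv_dilate {lam mu : ℝ} (hlam : 0 < lam) (hmu : 0 < mu) (h : lam * mu = 1)
    (u : Distr n 𝕜) : dilate lam hlam (dilate mu hmu u) = u := by
  ext φ
  rw [dilate_apply, dilate_apply, ← mul_assoc, ← RCLike.ofReal_mul, ← mul_inv, ← mul_pow, h,
    one_pow, inv_one, RCLike.ofReal_one, one_mul]
  congr 1
  ext x
  have hlm : lam⁻¹ * mu⁻¹ = 1 := by rw [← mul_inv, h, inv_one]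
  change φ (lam⁻¹ • mu⁻¹ • x) = φ x
  rw [smul_smul, hlm, one_smul]

theorem translate_dilate {lam : ℝ} (hlam : 0 < lam) (y : Space n) (u : Distr n 𝕜)
    (φ : 𝓢(Space n, 𝕜)) :
    translate y (dilate lam hlam u) φ = dilate lam hlam (translate (lam • y) u) φ := by
  rw [translate_apply, dilate_apply, dilate_apply, translate_apply]
  congr 2
  ext x
  change φ (lam⁻¹ • x - -y) = φ (lam⁻¹ • (x - -(lam • y)))
  congr 1
  rw [sub_neg_eq_add, sub_neg_eq_add, smul_add, smul_smul, inv_mul_cancel₀ hlam.ne', one_smul]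

theorem IsConv.dilate {k : Space n → ℝ} {u v : Distr n 𝕜} (h : IsConv k u v) {lam : ℝ}
    (hlam : 0 < lam) : IsConv (fun y => lam ^ n * k (lam • y)) (dilate lam hlam u)
      (FracHeat.dilate lam hlam v) := by
  refine ⟨fun φ => ?_, fun φ => ?_⟩
  · obtain ⟨C, hC⟩ := h.1 (SchwartzMap.compCLMOfContinuousLinearEquiv 𝕜
      (ContinuousLinearEquiv.smulLeft (M₁ := Space n) (R₁ := ℝ) (Units.mk0 lam hlam.ne')⁻¹) φ)
    refine ⟨‖(((lam ^ n)⁻¹ : ℝ) : 𝕜)‖ * C, fun y => ?_⟩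
    rw [translate_dilate, dilate_apply, norm_mul]
    gcongr
    exact hC _
  · simp only [translate_dilate, dilate_apply, h.2]
    set ψ := SchwartzMap.compCLMOfContinuousLinearEquiv 𝕜
      (ContinuousLinearEquiv.smulLeft (M₁ := Space n) (R₁ := ℝ) (Units.mk0 lam hlam.ne')⁻¹) φ
    have := Measure.integral_comp_smul_of_nonneg volume
      (fun y : Space n => k y • translate y u ψ) lam (hR := hlam.le)
    rw [finrank_euclideanSpace_fin] at this
    have hn : (lam ^ n : ℝ) ≠ 0 := by positivity
    rw [← inv_smul_eq_iff₀ (inv_ne_zero hn), inv_inv, ← integral_smul] at this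
    rw [← this, ← integral_const_mul]
    congr 1
    ext y
    simp only [RCLike.real_smul_eq_coe_mul]
    push_cast
    ring

variable {β : ℝ}

theorem IsHeat.add (hβ : 0 < β) {t : ℝ} (ht : 0 < t) {u v u' v' : Distr n 𝕜}
    (h : IsHeat β t u v) (h' : IsHeat β t u' v') : IsHeat β t (u + u') (v + v') :=
  IsConv.add (integrable_kernel hβ ht) h h'

theorem IsHeat.sub (hβ : 0 < β) {t : ℝ} (ht : 0 < t) {u v u' v' : Distr n 𝕜}
    (h : IsHeat β t u v) (h' : IsHeat β t u' v') : IsHeat β t (u - u') (v - v') :=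
  IsConv.sub (integrable_kernel hβ ht) h h'

theorem IsHeat.comp (hβ : 0 < β) {s t : ℝ} (hs : 0 < s) (ht : 0 < t) {u v w : Distr n 𝕜}
    (h : IsHeat β t u v) (h' : IsHeat β s v w) : IsHeat β (s + t) u w :=
  (IsConv.comp (integrable_kernel hβ ht) (integrable_kernel hβ hs) h h').congr_ae
    (convolution_kernel hβ hs ht)

theorem IsHeat.dilate {t : ℝ} {u v : Distr n 𝕜} (h : IsHeat β t u v) {lam : ℝ} (hlam : 0 < lam) :
    IsHeat β (lam ^ (-β) * t) (dilate lam hlam u) (FracHeat.dilate lam hlam v) := by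
  have := IsConv.dilate h hlam
  rwa [← funext (kernel_smul (n := n) (β := β) t hlam)] at this

end Translations

end FracHeat

namespace FracHeat

section BetaWeights

theorem integrableOn_beta {c d : ℝ} (hc : -1 < c) (hd : -1 < d) :
    IntegrableOn (fun σ : ℝ => (1 - σ) ^ c * σ ^ d) (Ioo 0 1) := by
  have h := (Complex.betaIntegral_convergent (u := ((d + 1 : ℝ) : ℂ)) (v := ((c + 1 : ℝ) : ℂ))
    (by simpa using by linarith) (by simpa using by linarith)).norm
  rw [intervalIntegrable_iff_integrableOn_Ioo_of_le zero_le_one] at h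
  refine h.congr_fun (fun σ hσ => ?_) measurableSet_Ioo
  have h1 : (0 : ℝ) < 1 - σ := sub_pos.2 hσ.2
  have e1 : (1 - (σ : ℂ)) = ((1 - σ : ℝ) : ℂ) := by push_cast; ring
  simp only [norm_mul, e1, Complex.norm_cpow_eq_rpow_re_of_pos hσ.1,
    Complex.norm_cpow_eq_rpow_re_of_pos h1]
  simp [mul_comm]

variable {F : Type*} [NormedAddCommGroup F]

theorem integrableOn_Ioo_iff_comp_mul (f : ℝ → F) {t : ℝ} (ht : 0 < t) :
    IntegrableOn f (Ioo 0 t) ↔ IntegrableOn (fun σ => f (t * σ)) (Ioo 0 1) := by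
  rw [← integrable_indicator_iff measurableSet_Ioo, ← integrable_indicator_iff measurableSet_Ioo,
    ← integrable_comp_mul_left_iff _ ht.ne']
  refine integrable_congr (Eventually.of_forall fun σ => ?_)
  have : t * σ ∈ Ioo 0 t ↔ σ ∈ Ioo (0 : ℝ) 1 := by
    simp only [mem_Ioo, mul_pos_iff_of_pos_left ht]
    rw [← mul_lt_mul_iff_right₀ ht (c := 1), mul_one]
  by_cases h : σ ∈ Ioo (0 : ℝ) 1
  · rw [indicator_of_mem h]
    exact indicator_of_mem (this.2 h) f
  · rw [indicator_of_notMem h]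
    exact indicator_of_notMem (mt this.1 h) f

variable [NormedSpace ℝ F]

theorem setIntegral_Ioo_eq_smul (f : ℝ → F) {t : ℝ} (ht : 0 < t) :
    ∫ τ in Ioo 0 t, f τ = t • ∫ σ in Ioo (0 : ℝ) 1, f (t * σ) := by
  have := intervalIntegral.smul_integral_comp_mul_left (a := 0) (b := 1) f t
  rw [mul_zero, mul_one, intervalIntegral.integral_of_le zero_le_one,
    intervalIntegral.integral_of_le ht.le, integral_Ioc_eq_integral_Ioo,
    integral_Ioc_eq_integral_Ioo] at this
  exact this.symm

theorem weight_mul_eq {c d t σ : ℝ} (ht : 0 < t) (hσ : σ ∈ Ioo (0 : ℝ) 1) :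
    (t - t * σ) ^ c * (t * σ) ^ d = t ^ (c + d) * ((1 - σ) ^ c * σ ^ d) := by
  rw [show t - t * σ = t * (1 - σ) by ring, Real.mul_rpow ht.le (sub_nonneg.2 hσ.2.le),
    Real.mul_rpow ht.le hσ.1.le, Real.rpow_add ht]
  ring

theorem integrableOn_weight {c d : ℝ} (hc : -1 < c) (hd : -1 < d) {t : ℝ} (ht : 0 < t) :
    IntegrableOn (fun τ : ℝ => (t - τ) ^ c * τ ^ d) (Ioo 0 t) := by
  rw [integrableOn_Ioo_iff_comp_mul _ ht]
  exact IntegrableOn.congr_fun ((integrableOn_beta hc hd).const_mul _)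
    (fun σ hσ => (weight_mul_eq ht hσ).symm) measurableSet_Ioo

theorem integral_weight {c d : ℝ} {t : ℝ} (ht : 0 < t) :
    ∫ τ in Ioo 0 t, (t - τ) ^ c * τ ^ d =
      t ^ (c + d + 1) * ∫ σ in Ioo (0 : ℝ) 1, (1 - σ) ^ c * σ ^ d := by
  rw [setIntegral_Ioo_eq_smul _ ht, setIntegral_congr_fun measurableSet_Ioo
    (fun σ hσ => weight_mul_eq ht hσ), integral_const_mul, smul_eq_mul, Real.rpow_add_one ht.ne']
  ring

theorem norm_setIntegral_le_weight {f : ℝ → F} {c d A : ℝ} (hc : -1 < c) (hd : -1 < d) {t : ℝ}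
    (ht : 0 < t) (hf : ∀ τ ∈ Ioo 0 t, ‖f τ‖ ≤ A * ((t - τ) ^ c * τ ^ d)) :
    ‖∫ τ in Ioo 0 t, f τ‖ ≤
      A * (t ^ (c + d + 1) * ∫ σ in Ioo (0 : ℝ) 1, (1 - σ) ^ c * σ ^ d) := by
  rw [← integral_weight ht, ← integral_const_mul]
  exact norm_integral_le_of_norm_le ((integrableOn_weight hc hd ht).const_mul A)
    ((ae_restrict_iff' measurableSet_Ioo).2 (Eventually.of_forall hf))

end BetaWeights

section Duhamel

variable {𝕜 : Type*} [RCLike 𝕜] {E F : Type*} [NormedAddCommGroup E] [NormedSpace 𝕜 E]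
  [NormedAddCommGroup F] [NormedSpace 𝕜 F] {p : ℕ}
  {G : ℝ → ContinuousMultilinearMap 𝕜 (fun _ : Fin p => E) F} {C c θ M : ℝ}

theorem norm_form_le (hG : ∀ s, 0 < s → ‖G s‖ ≤ C * s ^ c) {u : ℝ → E} {s τ : ℝ} (hs : 0 < s)
    (hτ : 0 < τ) (hu : ‖u τ‖ ≤ M * τ ^ (-θ)) :
    ‖G s fun _ => u τ‖ ≤ C * M ^ p * (s ^ c * τ ^ (-(p * θ))) := by
  have h1 := (G s).le_opNorm fun _ => u τ
  rw [Finset.prod_const, Finset.card_univ, Fintype.card_fin] at h1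
  have h2 : τ ^ (-(p * θ)) = (τ ^ (-θ)) ^ p := by
    rw [← Real.rpow_natCast, ← Real.rpow_mul hτ.le]; congr 1; ring
  calc _ ≤ ‖G s‖ * ‖u τ‖ ^ p := h1
    _ ≤ (C * s ^ c) * (M * τ ^ (-θ)) ^ p := by
      have := (norm_nonneg (G s)).trans (hG s hs)
      gcongr
      exact hG s hs
    _ = _ := by rw [h2, mul_pow]; ring

theorem norm_form_sub_le (hG : ∀ s, 0 < s → ‖G s‖ ≤ C * s ^ c) {u v : ℝ → E} {s τ h : ℝ}
    (hs : 0 < s) (hτ : 0 < τ) (hp : 1 ≤ p) (hu : ‖u τ‖ ≤ M * τ ^ (-θ))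
    (hv : ‖v τ‖ ≤ M * τ ^ (-θ)) (huv : ‖u τ - v τ‖ ≤ h * τ ^ (-θ)) :
    ‖(G s fun _ => u τ) - G s fun _ => v τ‖ ≤
      p * C * M ^ (p - 1) * h * (s ^ c * τ ^ (-(p * θ))) := by
  have h1 := (G s).norm_image_sub_le (fun _ => u τ) (fun _ => v τ)
  have hne : Nonempty (Fin p) := ⟨⟨0, hp⟩⟩
  have e1 : (fun _ : Fin p => u τ) - (fun _ => v τ) = fun _ => u τ - v τ := rfl
  rw [Fintype.card_fin, e1, pi_norm_const, pi_norm_const, pi_norm_const] at h1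
  have h2 : τ ^ (-(p * θ)) = (τ ^ (-θ)) ^ (p - 1) * τ ^ (-θ) := by
    rw [← pow_succ, Nat.sub_add_cancel hp, ← Real.rpow_natCast, ← Real.rpow_mul hτ.le]
    congr 1; ring
  have h3 := (norm_nonneg (G s)).trans (hG s hs)
  have h4 : 0 ≤ M * τ ^ (-θ) := (norm_nonneg _).trans hu
  calc _ ≤ ‖G s‖ * p * max ‖u τ‖ ‖v τ‖ ^ (p - 1) * ‖u τ - v τ‖ := h1
    _ ≤ (C * s ^ c) * p * (M * τ ^ (-θ)) ^ (p - 1) * (h * τ ^ (-θ)) := by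
      gcongr
      · exact hG s hs
      · exact max_le hu hv
    _ = _ := by rw [h2, mul_pow]; ring

theorem continuousOn_form (hGc : ContinuousOn G (Ioi 0)) {u : ℝ → E}
    (huc : ContinuousOn u (Ioi 0)) {X : Type*} [TopologicalSpace X] {a b : X → ℝ} {s : Set X}
    (ha : ContinuousOn a s) (hb : ContinuousOn b s) (ha0 : ∀ x ∈ s, 0 < a x)
    (hb0 : ∀ x ∈ s, 0 < b x) : ContinuousOn (fun x => G (a x) fun _ => u (b x)) s :=
  (hGc.comp ha ha0).eval (continuousOn_pi.2 fun _ => huc.comp hb hb0)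

theorem integrableOn_form (hc : -1 < c) (hpθ : p * θ < 1) (hGc : ContinuousOn G (Ioi 0))
    (hG : ∀ s, 0 < s → ‖G s‖ ≤ C * s ^ c) {u : ℝ → E}
    (huc : ContinuousOn u (Ioi 0)) (hu : ∀ τ, 0 < τ → ‖u τ‖ ≤ M * τ ^ (-θ)) {t : ℝ} (ht : 0 < t) :
    IntegrableOn (fun τ => G (t - τ) fun _ => u τ) (Ioo 0 t) := by
  refine ((integrableOn_weight hc (d := -(p * θ)) (by linarith) ht).const_mul (C * M ^ p)).mono' ?_
    ((ae_restrict_iff' measurableSet_Ioo).2 (Eventually.of_forall fun τ hτ =>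
      norm_form_le hG (sub_pos.2 hτ.2) hτ.1 (hu τ hτ.1)))
  refine ContinuousOn.aestronglyMeasurable ?_ measurableSet_Ioo
  exact continuousOn_form hGc huc (by fun_prop) (by fun_prop) (fun τ hτ => sub_pos.2 hτ.2)
    fun τ hτ => hτ.1

variable [NormedSpace ℝ F]

/-- The Duhamel term `∫₀ᵗ G(t-τ)(u(τ), …, u(τ)) dτ`. -/
noncomputable def duhamel (G : ℝ → ContinuousMultilinearMap 𝕜 (fun _ : Fin p => E) F)
    (u : ℝ → E) (t : ℝ) : F :=
  ∫ τ in Ioo 0 t, G (t - τ) fun _ => u τ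

theorem norm_duhamel_le (hc : -1 < c) (hpθ : p * θ < 1)
    (hG : ∀ s, 0 < s → ‖G s‖ ≤ C * s ^ c) {u : ℝ → E}
    (hu : ∀ τ, 0 < τ → ‖u τ‖ ≤ M * τ ^ (-θ)) {t : ℝ} (ht : 0 < t) :
    ‖duhamel G u t‖ ≤ C * M ^ p *
      (t ^ (c + -(p * θ) + 1) * ∫ σ in Ioo (0 : ℝ) 1, (1 - σ) ^ c * σ ^ (-(p * θ))) :=
  norm_setIntegral_le_weight hc (by linarith) ht fun τ hτ =>
    norm_form_le hG (sub_pos.2 hτ.2) hτ.1 (hu τ hτ.1)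

theorem continuousOn_duhamel (hc : -1 < c) (hpθ : p * θ < 1) (hGc : ContinuousOn G (Ioi 0))
    (hG : ∀ s, 0 < s → ‖G s‖ ≤ C * s ^ c) (hM : 0 ≤ M) {u : ℝ → E}
    (huc : ContinuousOn u (Ioi 0)) (hu : ∀ τ, 0 < τ → ‖u τ‖ ≤ M * τ ^ (-θ)) :
    ContinuousOn (duhamel G u) (Ioi 0) := by
  have e : ∀ t ∈ Ioi (0 : ℝ), duhamel G u t =
      t • ∫ σ in Ioo (0 : ℝ) 1, G (t - t * σ) fun _ => u (t * σ) := fun t ht => by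
    rw [duhamel, setIntegral_Ioo_eq_smul _ ht]
  refine ContinuousOn.congr (fun t ht => ?_) e
  refine ContinuousAt.continuousWithinAt (continuousAt_id.smul ?_)
  have ht0 : (0 : ℝ) < t := ht
  have hpow : ∀ᶠ x in 𝓝 t, x ^ (c + -(p * θ)) ≤ t ^ (c + -(p * θ)) + 1 :=
    (Real.continuousAt_rpow_const t _ (Or.inl ht0.ne')).eventually_le_const (by linarith)
  refine continuousAt_of_dominated
    (bound := fun σ => C * M ^ p * (t ^ (c + -(p * θ)) + 1) * ((1 - σ) ^ c * σ ^ (-(p * θ))))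
    ?_ ?_ ((integrableOn_beta hc (by linarith)).const_mul _) ?_
  · filter_upwards [lt_mem_nhds ht0] with x hx
    refine ContinuousOn.aestronglyMeasurable ?_ measurableSet_Ioo
    exact continuousOn_form hGc huc (by fun_prop) (by fun_prop)
      (fun σ hσ => by nlinarith [hσ.1, hσ.2]) fun σ hσ => mul_pos hx hσ.1
  · filter_upwards [lt_mem_nhds ht0, hpow] with x hx hx'
    refine (ae_restrict_iff' measurableSet_Ioo).2 (Eventually.of_forall fun σ hσ => ?_)
    have h1 := norm_form_le (u := u) hG (show 0 < x - x * σ by nlinarith [hσ.1, hσ.2])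
      (mul_pos hx hσ.1) (hu _ (mul_pos hx hσ.1))
    refine h1.trans ?_
    rw [weight_mul_eq hx hσ]
    have h2 : 0 ≤ C := by
      have := (norm_nonneg (G 1)).trans (hG 1 one_pos)
      rwa [Real.one_rpow, mul_one] at this
    have h3 : 0 ≤ (1 - σ) ^ c * σ ^ (-(p * θ)) :=
      mul_nonneg (Real.rpow_nonneg (sub_nonneg.2 hσ.2.le) _) (Real.rpow_nonneg hσ.1.le _)
    rw [mul_assoc (C * M ^ p)]
    gcongr
  · refine (ae_restrict_iff' measurableSet_Ioo).2 (Eventually.of_forall fun σ hσ => ?_)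
    have h1 := continuousOn_form (s := Ioi (0 : ℝ)) (a := fun x => x - x * σ)
      (b := fun x => x * σ) hGc huc (by fun_prop) (by fun_prop)
      (fun x hx => by
        have : (0 : ℝ) < x := hx
        nlinarith [hσ.1, hσ.2]) fun x hx => mul_pos hx hσ.1
    exact h1.continuousAt (Ioi_mem_nhds ht0)

theorem norm_duhamel_sub_le_integral (hc : -1 < c) (hpθ : p * θ < 1) (hp : 1 ≤ p)
    (hG : ∀ s, 0 < s → ‖G s‖ ≤ C * s ^ c) {u v : ℝ → E} {h : ℝ → ℝ} {N : ℝ} {t : ℝ} (ht : 0 < t)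
    (hu : ∀ τ, 0 < τ → ‖u τ‖ ≤ M * τ ^ (-θ)) (hv : ∀ τ, 0 < τ → ‖v τ‖ ≤ M * τ ^ (-θ))
    (huv : ∀ τ, 0 < τ → ‖u τ - v τ‖ ≤ h τ * τ ^ (-θ)) (hh : AntitoneOn h (Ioi 0))
    (hN : ∀ τ, 0 < τ → ‖h τ‖ ≤ N)
    (hui : IntegrableOn (fun τ => G (t - τ) fun _ => u τ) (Ioo 0 t))
    (hvi : IntegrableOn (fun τ => G (t - τ) fun _ => v τ) (Ioo 0 t)) :
    ‖duhamel G u t - duhamel G v t‖ ≤ t ^ (c + -(p * θ) + 1) *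
      ∫ σ in Ioo (0 : ℝ) 1, p * C * M ^ (p - 1) * ((1 - σ) ^ c * σ ^ (-(p * θ))) * h (t * σ) := by
  have hhm : AEStronglyMeasurable h (volume.restrict (Ioo 0 t)) :=
    (aemeasurable_restrict_of_antitoneOn measurableSet_Ioo
      (hh.mono fun τ hτ => hτ.1)).aestronglyMeasurable
  have hint : IntegrableOn (fun τ => p * C * M ^ (p - 1) * h τ *
      ((t - τ) ^ c * τ ^ (-(p * θ)))) (Ioo 0 t) := by
    have h1 := (integrableOn_weight hc (d := -(p * θ)) (by linarith) ht).bdd_mul (c := N) hhm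
      ((ae_restrict_iff' measurableSet_Ioo).2 (Eventually.of_forall fun τ hτ => hN τ hτ.1))
    refine (h1.const_mul (p * C * M ^ (p - 1))).congr (Eventually.of_forall fun τ => ?_)
    simp only [mul_assoc]
  rw [duhamel, duhamel, ← integral_sub hui hvi]
  refine (norm_integral_le_of_norm_le hint ((ae_restrict_iff' measurableSet_Ioo).2
    (Eventually.of_forall fun τ hτ => norm_form_sub_le hG (sub_pos.2 hτ.2) hτ.1 hp
      (hu τ hτ.1) (hv τ hτ.1) (huv τ hτ.1)))).trans (le_of_eq ?_)
  rw [setIntegral_Ioo_eq_smul _ ht, Real.rpow_add_one ht.ne', smul_eq_mul,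
    mul_comm (t ^ (c + -(p * θ))) t, mul_assoc t]
  congr 1
  rw [← integral_const_mul]
  refine setIntegral_congr_fun measurableSet_Ioo fun σ hσ => ?_
  simp only [weight_mul_eq ht hσ]
  ring

theorem norm_duhamel_sub_le (hc : -1 < c) (hpθ : p * θ < 1) (hp : 1 ≤ p)
    (hG : ∀ s, 0 < s → ‖G s‖ ≤ C * s ^ c) {u v : ℝ → E} {D : ℝ} {t : ℝ} (ht : 0 < t)
    (hu : ∀ τ, 0 < τ → ‖u τ‖ ≤ M * τ ^ (-θ)) (hv : ∀ τ, 0 < τ → ‖v τ‖ ≤ M * τ ^ (-θ))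
    (huv : ∀ τ, 0 < τ → ‖u τ - v τ‖ ≤ D * τ ^ (-θ))
    (hui : IntegrableOn (fun τ => G (t - τ) fun _ => u τ) (Ioo 0 t))
    (hvi : IntegrableOn (fun τ => G (t - τ) fun _ => v τ) (Ioo 0 t)) :
    ‖duhamel G u t - duhamel G v t‖ ≤ p * (C * ∫ σ in Ioo (0 : ℝ) 1,
      (1 - σ) ^ c * σ ^ (-(p * θ))) * M ^ (p - 1) * D * t ^ (c + -(p * θ) + 1) := by
  refine (norm_duhamel_sub_le_integral hc hpθ hp hG (h := fun _ => D) (N := ‖D‖) ht hu hv huv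
    antitoneOn_const (fun _ _ => le_rfl) hui hvi).trans (le_of_eq ?_)
  rw [integral_mul_const, integral_const_mul]
  ring

end Duhamel

end FracHeat

namespace FracHeat

open scoped BoundedContinuousFunction

section FixedPoint

variable {E : Type*} [NormedAddCommGroup E] [NormedSpace ℝ E]

/-- The function `τ ↦ τ^(-θ) v(τ)` on `(0, ∞)`. -/
noncomputable def unweight (θ : ℝ) (v : Ioi (0 : ℝ) →ᵇ E) (τ : ℝ) : E :=
  if h : 0 < τ then τ ^ (-θ) • v ⟨τ, h⟩ else 0

theorem unweight_of_pos (θ : ℝ) (v : Ioi (0 : ℝ) →ᵇ E) {τ : ℝ} (h : 0 < τ) :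
    unweight θ v τ = τ ^ (-θ) • v ⟨τ, h⟩ := dif_pos h

theorem norm_unweight_le (θ : ℝ) (v : Ioi (0 : ℝ) →ᵇ E) {τ : ℝ} (h : 0 < τ) :
    ‖unweight θ v τ‖ ≤ ‖v‖ * τ ^ (-θ) := by
  rw [unweight_of_pos θ v h, norm_smul, Real.norm_of_nonneg (by positivity), mul_comm]
  gcongr
  exact v.norm_coe_le_norm _

theorem norm_unweight_sub_le (θ : ℝ) (v w : Ioi (0 : ℝ) →ᵇ E) {τ : ℝ} (h : 0 < τ) :
    ‖unweight θ v τ - unweight θ w τ‖ ≤ ‖v - w‖ * τ ^ (-θ) := by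
  have : unweight θ v τ - unweight θ w τ = unweight θ (v - w) τ := by
    simp only [unweight_of_pos θ _ h, BoundedContinuousFunction.coe_sub, Pi.sub_apply, smul_sub]
  rw [this]
  exact norm_unweight_le θ _ h

theorem continuousOn_unweight (θ : ℝ) (v : Ioi (0 : ℝ) →ᵇ E) :
    ContinuousOn (unweight θ v) (Ioi 0) := by
  rw [continuousOn_iff_continuous_domRestrict]
  have : (Ioi (0 : ℝ)).domRestrict (unweight θ v) =
      fun τ : Ioi (0 : ℝ) => (τ : ℝ) ^ (-θ) • v τ :=
    funext fun τ => unweight_of_pos θ v τ.2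
  rw [this]
  refine Continuous.smul ?_ v.continuous
  exact continuous_subtype_val.rpow_const fun τ => Or.inl (ne_of_gt τ.2)

variable {𝕜 : Type*} [RCLike 𝕜] [NormedSpace 𝕜 E] [CompleteSpace E] {p : ℕ}
  {G : ℝ → ContinuousMultilinearMap 𝕜 (fun _ : Fin p => E) E} {C θ M R : ℝ}

/-- Solution of the mild equation by the contraction principle in the space of continuous functions
with `sup t^θ ‖u(t)‖ < ∞`. -/
theorem exists_mild_solution (hθp : -1 < p * θ - θ - 1) (hpθ : p * θ < 1) (hp : 1 ≤ p)
    (hGc : ContinuousOn G (Ioi 0)) (hG : ∀ s, 0 < s → ‖G s‖ ≤ C * s ^ (p * θ - θ - 1))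
    {y : ℝ → E} (hyc : ContinuousOn y (Ioi 0)) (hy : ∀ t, 0 < t → ‖y t‖ ≤ R * t ^ (-θ))
    (hM : 0 ≤ M) {κ : ℝ} (hκ : κ = C * ∫ σ in Ioo (0 : ℝ) 1,
      (1 - σ) ^ (p * θ - θ - 1) * σ ^ (-(p * θ)))
    (hball : R + κ * M ^ p ≤ M) (hq : p * κ * M ^ (p - 1) < 1) :
    ∃ u : ℝ → E, ContinuousOn u (Ioi 0) ∧ (∀ t, 0 < t → ‖u t‖ ≤ M * t ^ (-θ)) ∧
      ∀ t, 0 < t → u t = y t + duhamel G u t := by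
  have hexp : p * θ - θ - 1 + -(p * θ) + 1 = -θ := by ring
  have hC0 : 0 ≤ C := by
    have := (norm_nonneg (G 1)).trans (hG 1 one_pos)
    rwa [Real.one_rpow, mul_one] at this
  have hκ0 : 0 ≤ κ := by
    rw [hκ]
    refine mul_nonneg hC0 (setIntegral_nonneg measurableSet_Ioo fun σ hσ => ?_)
    exact mul_nonneg (Real.rpow_nonneg (sub_nonneg.2 hσ.2.le) _) (Real.rpow_nonneg hσ.1.le _)
  have hbd : ∀ v : Ioi (0 : ℝ) →ᵇ E, ∀ t, 0 < t →
      ‖y t + duhamel G (unweight θ v) t‖ ≤ (R + κ * ‖v‖ ^ p) * t ^ (-θ) := by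
    intro v t ht
    have h1 := norm_duhamel_le hθp hpθ hG (fun τ hτ => norm_unweight_le θ v hτ) ht
    rw [hexp] at h1
    refine (norm_add_le _ _).trans ((add_le_add (hy t ht) h1).trans (le_of_eq ?_))
    rw [hκ]; ring
  have hcont : ∀ v : Ioi (0 : ℝ) →ᵇ E, ContinuousOn
      (fun t => t ^ θ • (y t + duhamel G (unweight θ v) t)) (Ioi 0) := by
    intro v
    refine ContinuousOn.smul ?_ (hyc.add (continuousOn_duhamel hθp hpθ hGc hG (norm_nonneg v)
      (continuousOn_unweight θ v) fun τ hτ => norm_unweight_le θ v hτ))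
    exact continuousOn_id.rpow_const fun t ht => Or.inl (ne_of_gt ht)
  have hw : ∀ t : ℝ, 0 < t → t ^ θ * t ^ (-θ) = 1 := fun t ht => by
    rw [← Real.rpow_add ht, add_neg_cancel, Real.rpow_zero]
  let Ψ : (Ioi (0 : ℝ) →ᵇ E) → (Ioi (0 : ℝ) →ᵇ E) := fun v =>
    BoundedContinuousFunction.ofNormedAddCommGroup
      (fun t : Ioi (0 : ℝ) => (t : ℝ) ^ θ • (y t + duhamel G (unweight θ v) t))
      (continuousOn_iff_continuous_domRestrict.1 (hcont v)) (R + κ * ‖v‖ ^ p) fun t => by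
        have ht : (0 : ℝ) < t := t.2
        rw [norm_smul, Real.norm_of_nonneg (by positivity)]
        calc (t : ℝ) ^ θ * ‖y t + duhamel G (unweight θ v) t‖
            ≤ (t : ℝ) ^ θ * ((R + κ * ‖v‖ ^ p) * (t : ℝ) ^ (-θ)) := by gcongr; exact hbd v t ht
          _ = (R + κ * ‖v‖ ^ p) * ((t : ℝ) ^ θ * (t : ℝ) ^ (-θ)) := by ring
          _ = _ := by rw [hw t ht, mul_one]
  have hΨ : ∀ v (t : Ioi (0 : ℝ)), Ψ v t = (t : ℝ) ^ θ • (y t + duhamel G (unweight θ v) t) :=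
    fun v t => rfl
  have hmaps : MapsTo Ψ (Metric.closedBall 0 M) (Metric.closedBall 0 M) := by
    intro v hv
    rw [mem_closedBall_zero_iff] at hv ⊢
    rw [BoundedContinuousFunction.norm_le hM]
    intro t
    have ht : (0 : ℝ) < t := t.2
    rw [hΨ, norm_smul, Real.norm_of_nonneg (by positivity)]
    calc (t : ℝ) ^ θ * ‖y t + duhamel G (unweight θ v) t‖
        ≤ (t : ℝ) ^ θ * ((R + κ * ‖v‖ ^ p) * (t : ℝ) ^ (-θ)) := by gcongr; exact hbd v t ht
      _ = (R + κ * ‖v‖ ^ p) * ((t : ℝ) ^ θ * (t : ℝ) ^ (-θ)) := by ring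
      _ = R + κ * ‖v‖ ^ p := by rw [hw t ht, mul_one]
      _ ≤ R + κ * M ^ p := by gcongr
      _ ≤ M := hball
  have hq0 : 0 ≤ p * κ * M ^ (p - 1) := by positivity
  have hcontr : ContractingWith ⟨p * κ * M ^ (p - 1), hq0⟩
      (hmaps.restrict Ψ (Metric.closedBall 0 M) (Metric.closedBall 0 M)) := by
    refine ⟨by exact_mod_cast hq, LipschitzWith.of_dist_le_mul fun v w => ?_⟩
    rw [Subtype.dist_eq, Subtype.dist_eq, dist_eq_norm, dist_eq_norm,
      BoundedContinuousFunction.norm_le (by positivity)]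
    intro t
    have ht : (0 : ℝ) < t := t.2
    obtain ⟨v, hv⟩ := v
    obtain ⟨w, hw'⟩ := w
    rw [mem_closedBall_zero_iff] at hv hw'
    have hvb : ∀ τ, 0 < τ → ‖unweight θ v τ‖ ≤ M * τ ^ (-θ) := fun τ hτ =>
      (norm_unweight_le θ v hτ).trans (by gcongr)
    have hwb : ∀ τ, 0 < τ → ‖unweight θ w τ‖ ≤ M * τ ^ (-θ) := fun τ hτ =>
      (norm_unweight_le θ w hτ).trans (by gcongr)
    have h1 := norm_duhamel_sub_le hθp hpθ hp hG ht hvb hwb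
      (fun τ hτ => norm_unweight_sub_le θ v w hτ)
      (integrableOn_form hθp hpθ hGc hG (continuousOn_unweight θ v) hvb ht)
      (integrableOn_form hθp hpθ hGc hG (continuousOn_unweight θ w) hwb ht)
    rw [hexp, ← hκ] at h1
    change ‖Ψ v t - Ψ w t‖ ≤ p * κ * M ^ (p - 1) * ‖v - w‖
    rw [hΨ, hΨ, ← smul_sub, add_sub_add_left_eq_sub, norm_smul,
      Real.norm_of_nonneg (by positivity)]
    calc (t : ℝ) ^ θ * ‖duhamel G (unweight θ v) t - duhamel G (unweight θ w) t‖
        ≤ (t : ℝ) ^ θ * (p * κ * M ^ (p - 1) * ‖v - w‖ * (t : ℝ) ^ (-θ)) := by gcongr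
      _ = p * κ * M ^ (p - 1) * ‖v - w‖ * ((t : ℝ) ^ θ * (t : ℝ) ^ (-θ)) := by ring
      _ = _ := by rw [hw t ht, mul_one]
  obtain ⟨v, hv, hfix, -⟩ := hcontr.exists_fixedPoint'
    (Metric.isClosed_closedBall.isComplete) hmaps (Metric.mem_closedBall_self hM)
    (edist_ne_top _ _)
  rw [mem_closedBall_zero_iff] at hv
  refine ⟨unweight θ v, continuousOn_unweight θ v,
    fun t ht => (norm_unweight_le θ v ht).trans (by gcongr), fun t ht => ?_⟩
  have h1 : v ⟨t, ht⟩ = t ^ θ • (y t + duhamel G (unweight θ v) t) :=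
    (DFunLike.congr_fun hfix.symm ⟨t, ht⟩).trans (hΨ v ⟨t, ht⟩)
  rw [unweight_of_pos θ v ht, h1, smul_smul, mul_comm, hw t ht, one_smul]

end FixedPoint

section Asymptotics

/-- Asymptotic comparison: if `|g(t) - l(t)|` is controlled by averages of any nonincreasing
majorant of `g` against a weight of mass less than one, then `g` and `l` vanish at infinity
simultaneously. -/
theorem tendsto_zero_iff_of_average_bound {g l w : ℝ → ℝ} {N : ℝ} (hg0 : ∀ t, 0 < t → 0 ≤ g t)
    (hgN : ∀ t, 0 < t → g t ≤ N) (hw : IntegrableOn w (Ioo 0 1))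
    (hw1 : ∫ σ in Ioo (0 : ℝ) 1, w σ < 1)
    (H : ∀ h : ℝ → ℝ, AntitoneOn h (Ioi 0) → (∀ t, 0 < t → g t ≤ h t) → (∀ t, 0 < t → h t ≤ N) →
      ∀ t, 0 < t → |g t - l t| ≤ ∫ σ in Ioo (0 : ℝ) 1, w σ * h (t * σ)) :
    Tendsto g atTop (𝓝 0) ↔ Tendsto l atTop (𝓝 0) := by
  set h : ℝ → ℝ := fun t => sSup (g '' Ici t) with hh
  have hbdd : ∀ t, 0 < t → BddAbove (g '' Ici t) := fun t ht =>
    ⟨N, by rintro _ ⟨s, hs, rfl⟩; exact hgN s (lt_of_lt_of_le ht hs)⟩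
  have hgh : ∀ t, 0 < t → g t ≤ h t := fun t ht =>
    le_csSup (hbdd t ht) (mem_image_of_mem _ self_mem_Ici)
  have hle : ∀ t b, (∀ s, t ≤ s → g s ≤ b) → h t ≤ b := fun t b hb =>
    csSup_le (nonempty_Ici.image _) (by rintro _ ⟨s, hs, rfl⟩; exact hb s hs)
  have hhN : ∀ t, 0 < t → h t ≤ N := fun t ht =>
    hle t N fun s hs => hgN s (ht.trans_le hs)
  have hanti : AntitoneOn h (Ioi 0) := fun s hs t _ hst =>
    csSup_le_csSup (hbdd s hs) (nonempty_Ici.image _) (image_mono (Ici_subset_Ici.2 hst))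
  have hh0 : ∀ t, 0 < t → 0 ≤ h t := fun t ht => (hg0 t ht).trans (hgh t ht)
  obtain ⟨L, hL⟩ : ∃ L, Tendsto h atTop (𝓝 L) := by
    have hanti' : Antitone fun t => h (max t 1) := fun s t hst =>
      hanti (mem_Ioi.2 (lt_of_lt_of_le one_pos (le_max_right s 1)))
        (mem_Ioi.2 (lt_of_lt_of_le one_pos (le_max_right t 1))) (max_le_max hst le_rfl)
    refine ⟨_, Tendsto.congr' ?_ (tendsto_atTop_ciInf hanti' ⟨0, ?_⟩)⟩
    · filter_upwards [eventually_ge_atTop 1] with t ht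
      rw [max_eq_left ht]
    · rintro _ ⟨t, rfl⟩
      exact hh0 _ (lt_of_lt_of_le one_pos (le_max_right _ _))
  have hL0 : 0 ≤ L := ge_of_tendsto hL (by
    filter_upwards [eventually_gt_atTop 0] with t ht using hh0 t ht)
  have hav : Tendsto (fun t => ∫ σ in Ioo (0 : ℝ) 1, w σ * h (t * σ)) atTop
      (𝓝 (∫ σ in Ioo (0 : ℝ) 1, w σ * L)) := by
    refine tendsto_integral_filter_of_dominated_convergence (fun σ => ‖w σ‖ * N) ?_ ?_
      (hw.norm.mul_const N) ?_
    · filter_upwards [eventually_gt_atTop 0] with t ht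
      refine hw.aestronglyMeasurable.mul
        (aemeasurable_restrict_of_antitoneOn measurableSet_Ioo ?_).aestronglyMeasurable
      intro s hs s' hs' hss
      exact hanti (mul_pos ht hs.1) (mul_pos ht hs'.1) (by gcongr)
    · filter_upwards [eventually_gt_atTop 0] with t ht
      refine (ae_restrict_iff' measurableSet_Ioo).2 (Eventually.of_forall fun σ hσ => ?_)
      have hpos := mul_pos ht hσ.1
      rw [norm_mul, Real.norm_of_nonneg (hh0 _ hpos)]
      gcongr
      exact hhN _ hpos
    · refine (ae_restrict_iff' measurableSet_Ioo).2 (Eventually.of_forall fun σ hσ => ?_)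
      exact (hL.comp (tendsto_id.atTop_mul_const hσ.1)).const_mul _
  rw [integral_mul_const] at hav
  have key := H h hanti hgh hhN
  constructor
  · intro hg
    have hL' : L = 0 := by
      refine le_antisymm (le_of_forall_pos_le_add fun ε hε => ?_) hL0
      have h1 : ∀ᶠ t in atTop, h t ≤ 0 + ε := by
        obtain ⟨T, hT⟩ := eventually_atTop.1 (hg.eventually_le_const (show 0 < 0 + ε by linarith))
        filter_upwards [eventually_ge_atTop T] with t ht
        exact hle t _ fun s hs => hT s (ht.trans hs)
      exact le_of_tendsto hL h1
    rw [hL', mul_zero] at hav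
    have h2 : Tendsto (fun t => g t - l t) atTop (𝓝 0) :=
      squeeze_zero_norm' (by
        filter_upwards [eventually_gt_atTop 0] with t ht using key t ht) hav
    simpa using hg.sub h2
  · intro hl
    have h1 : L ≤ (∫ σ in Ioo (0 : ℝ) 1, w σ) * L := by
      refine le_of_forall_pos_le_add fun ε hε => ?_
      have h2 : ∀ᶠ t in atTop, l t + ∫ σ in Ioo (0 : ℝ) 1, w σ * h (t * σ) ≤
          (∫ σ in Ioo (0 : ℝ) 1, w σ) * L + ε :=
        (hl.add hav).eventually_le_const (by linarith)
      obtain ⟨T, hT⟩ := eventually_atTop.1 h2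
      refine le_of_tendsto hL ?_
      filter_upwards [eventually_ge_atTop (max T 1)] with t ht
      refine hle t _ fun s hs => ?_
      have hs1 : max T 1 ≤ s := ht.trans hs
      have hk := key s (lt_of_lt_of_le one_pos ((le_max_right _ _).trans hs1))
      have := hT s ((le_max_left _ _).trans hs1)
      linarith [le_abs_self (g s - l s)]
    have hL' : L = 0 := by nlinarith
    rw [hL'] at hL
    refine squeeze_zero' ?_ ?_ hL
    · filter_upwards [eventually_gt_atTop 0] with t ht using hg0 t ht
    · filter_upwards [eventually_gt_atTop 0] with t ht using hgh t ht

end Asymptotics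

end FracHeat

namespace FracHeat

open scoped BoundedContinuousFunction

section Orbits

variable {𝕜 : Type*} [RCLike 𝕜] {E : Type*} [NormedAddCommGroup E] [NormedSpace 𝕜 E] {p : ℕ}
  {S : ℝ → E →L[𝕜] E}

/-- A function whose increments are dominated by those of the semigroup is continuous. -/
theorem continuousOn_of_norm_sub_le (hS : ContinuousOn S (Ioi 0)) {X : Type*}
    [SeminormedAddCommGroup X] {f : ℝ → X} (hf : ∀ s₀, 0 < s₀ → ∃ D : ℝ, ∀ s s', s₀ < s → s₀ < s' →
      ‖f s - f s'‖ ≤ D * ‖S (s - s₀) - S (s' - s₀)‖) : ContinuousOn f (Ioi 0) := by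
  intro s hs
  have hs0 : (0 : ℝ) < s := hs
  obtain ⟨D, hD⟩ := hf (s / 2) (by positivity)
  refine ContinuousAt.continuousWithinAt ?_
  have h1 : ContinuousAt (fun x => S (x - s / 2)) s := by
    refine ContinuousAt.comp (g := S) ?_ (by fun_prop)
    exact hS.continuousAt (Ioi_mem_nhds (by linarith))
  have h2 : Tendsto (fun x => D * ‖S (x - s / 2) - S (s - s / 2)‖) (𝓝 s) (𝓝 0) := by
    have h3 : Tendsto (fun x => S (x - s / 2) - S (s - s / 2)) (𝓝 s) (𝓝 0) := by
      simpa using Tendsto.sub_const h1 (S (s - s / 2))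
    simpa using h3.norm.const_mul D
  rw [ContinuousAt, tendsto_iff_norm_sub_tendsto_zero]
  refine squeeze_zero' (Eventually.of_forall fun _ => norm_nonneg _) ?_ h2
  filter_upwards [lt_mem_nhds (show s / 2 < s by linarith)] with x hx
  exact hD x s hx (by linarith)

theorem continuousOn_of_semigroup (hS : ContinuousOn S (Ioi 0)) {y : ℝ → E}
    (hy : ∀ r s, 0 < r → 0 < s → S r (y s) = y (r + s)) : ContinuousOn y (Ioi 0) := by
  refine continuousOn_of_norm_sub_le hS fun s₀ hs₀ => ⟨‖y s₀‖, fun s s' hs hs' => ?_⟩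
  have e1 := hy (s - s₀) s₀ (sub_pos.2 hs) hs₀
  have e2 := hy (s' - s₀) s₀ (sub_pos.2 hs') hs₀
  rw [sub_add_cancel] at e1 e2
  rw [← e1, ← e2, ← sub_apply, mul_comm]
  exact ContinuousLinearMap.le_opNorm _ _

theorem continuousOn_form_of_semigroup (hS : ContinuousOn S (Ioi 0))
    {G : ℝ → ContinuousMultilinearMap 𝕜 (fun _ : Fin p => E) E}
    (hSG : ∀ r s, 0 < r → 0 < s → ∀ u, S r (G s u) = G (r + s) u) : ContinuousOn G (Ioi 0) := by
  refine continuousOn_of_norm_sub_le hS fun s₀ hs₀ => ⟨‖G s₀‖, fun s s' hs hs' => ?_⟩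
  refine ContinuousMultilinearMap.opNorm_le_bound (by positivity) fun u => ?_
  have e1 := hSG (s - s₀) s₀ (sub_pos.2 hs) hs₀ u
  have e2 := hSG (s' - s₀) s₀ (sub_pos.2 hs') hs₀ u
  rw [sub_add_cancel] at e1 e2
  rw [sub_apply, ← e1, ← e2, ← sub_apply]
  calc _ ≤ ‖S (s - s₀) - S (s' - s₀)‖ * ‖G s₀ u‖ := ContinuousLinearMap.le_opNorm _ _
    _ ≤ ‖S (s - s₀) - S (s' - s₀)‖ * (‖G s₀‖ * ∏ i, ‖u i‖) := by
      gcongr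
      exact (G s₀).le_opNorm u
    _ = _ := by ring

variable {θ : ℝ}

theorem continuous_rpow_smul_shift {x : ℝ → E} (hx : ContinuousOn x (Ioi 0)) {s : ℝ} (hs : 0 < s) :
    Continuous fun r : Ioi (0 : ℝ) => (((r : ℝ) ^ θ : ℝ) : 𝕜) • x (r + s) := by
  refine Continuous.smul (RCLike.continuous_ofReal.comp
    (continuous_subtype_val.rpow_const fun r => Or.inl (ne_of_gt r.2))) ?_
  refine hx.comp_continuous (by fun_prop) fun r => ?_
  have : (0 : ℝ) < r := r.2
  exact add_pos this hs

theorem norm_rpow_smul {r : ℝ} (hr : 0 < r) (x : E) :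
    ‖((r ^ θ : ℝ) : 𝕜) • x‖ = r ^ θ * ‖x‖ := by
  rw [norm_smul, RCLike.norm_ofReal, abs_of_nonneg (Real.rpow_nonneg hr.le _)]

/-- The orbit `r ↦ r^θ y(r + t)` as a bounded continuous function, continuous in `t`. -/
theorem exists_orbit (hS : ContinuousOn S (Ioi 0)) {y : ℝ → E} {R : ℝ} (hθ : 0 < θ)
    (hy : ∀ r s, 0 < r → 0 < s → S r (y s) = y (r + s))
    (hyR : ∀ t, 0 < t → t ^ θ * ‖y t‖ ≤ R) :
    ∃ Y : ℝ → (Ioi (0 : ℝ) →ᵇ E), ContinuousOn Y (Ioi 0) ∧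
      ∀ t, 0 < t → ‖Y t‖ ≤ R ∧ ∀ r : Ioi (0 : ℝ), Y t r = (((r : ℝ) ^ θ : ℝ) : 𝕜) • y (r + t) := by
  have hR : 0 ≤ R := (by positivity : (0 : ℝ) ≤ 1 ^ θ * ‖y 1‖).trans (hyR 1 one_pos)
  have hb : ∀ r t, 0 < r → 0 < t → r ^ θ * ‖y (r + t)‖ ≤ R := fun r t hr ht =>
    le_trans (by gcongr; linarith) (hyR (r + t) (add_pos hr ht))
  have hex : ∀ t : ℝ, ∃ Y : Ioi (0 : ℝ) →ᵇ E, 0 < t → ‖Y‖ ≤ R ∧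
      ∀ r : Ioi (0 : ℝ), Y r = (((r : ℝ) ^ θ : ℝ) : 𝕜) • y (r + t) := by
    intro t
    by_cases ht : 0 < t
    · have hbd : ∀ r : Ioi (0 : ℝ), ‖(((r : ℝ) ^ θ : ℝ) : 𝕜) • y (r + t)‖ ≤ R := fun r => by
        rw [norm_rpow_smul r.2]
        exact hb r t r.2 ht
      exact ⟨BoundedContinuousFunction.ofNormedAddCommGroup _
        (continuous_rpow_smul_shift (continuousOn_of_semigroup hS hy) ht) R hbd,
        fun _ => ⟨BoundedContinuousFunction.norm_ofNormedAddCommGroup_le _ hR hbd, fun _ => rfl⟩⟩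
    · exact ⟨0, fun h => absurd h ht⟩
  choose Y hY using hex
  refine ⟨Y, ?_, hY⟩
  refine continuousOn_of_norm_sub_le hS fun s₀ hs₀ => ⟨R, fun s s' hs hs' => ?_⟩
  rw [BoundedContinuousFunction.norm_le (by positivity)]
  intro r
  have hr : (0 : ℝ) < r := r.2
  have e1 := hy (s - s₀) (r + s₀) (sub_pos.2 hs) (add_pos hr hs₀)
  have e2 := hy (s' - s₀) (r + s₀) (sub_pos.2 hs') (add_pos hr hs₀)
  rw [show s - s₀ + (r + s₀) = r + s by ring] at e1
  rw [show s' - s₀ + (r + s₀) = r + s' by ring] at e2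
  rw [BoundedContinuousFunction.sub_apply, (hY s (hs₀.trans hs)).2, (hY s' (hs₀.trans hs')).2,
    ← smul_sub, norm_rpow_smul hr, ← e1, ← e2, ← sub_apply]
  calc _ ≤ (r : ℝ) ^ θ * (‖S (s - s₀) - S (s' - s₀)‖ * ‖y (r + s₀)‖) := by
        gcongr
        exact ContinuousLinearMap.le_opNorm _ _
    _ = ((r : ℝ) ^ θ * ‖y (r + s₀)‖) * ‖S (s - s₀) - S (s' - s₀)‖ := by ring
    _ ≤ _ := by gcongr; exact hb r s₀ hr hs₀

/-- The orbits `r ↦ r^θ G(r + s)(u)` as a multilinear map with values in bounded continuous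
functions, continuous in `s`. -/
theorem exists_orbit_form (hS : ContinuousOn S (Ioi 0))
    {G : ℝ → ContinuousMultilinearMap 𝕜 (fun _ : Fin p => E) E} {C e : ℝ} (hC : 0 ≤ C)
    (hSG : ∀ r s, 0 < r → 0 < s → ∀ u, S r (G s u) = G (r + s) u)
    (hG : ∀ r s, 0 < r → 0 < s → ∀ u : Fin p → E,
      r ^ θ * ‖G (r + s) u‖ ≤ C * s ^ e * ∏ i, ‖u i‖) :
    ∃ Γ : ℝ → ContinuousMultilinearMap 𝕜 (fun _ : Fin p => E) (Ioi (0 : ℝ) →ᵇ E),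
      ContinuousOn Γ (Ioi 0) ∧ (∀ s, 0 < s → ‖Γ s‖ ≤ C * s ^ e) ∧
      ∀ s, 0 < s → ∀ u (r : Ioi (0 : ℝ)), Γ s u r = (((r : ℝ) ^ θ : ℝ) : 𝕜) • G (r + s) u := by
  have hex : ∀ s : ℝ, ∃ Γ : ContinuousMultilinearMap 𝕜 (fun _ : Fin p => E) (Ioi (0 : ℝ) →ᵇ E),
      0 < s → ‖Γ‖ ≤ C * s ^ e ∧
      ∀ u (r : Ioi (0 : ℝ)), Γ u r = (((r : ℝ) ^ θ : ℝ) : 𝕜) • G (r + s) u := by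
    intro s
    by_cases hs : 0 < s
    · have hbd : ∀ u (r : Ioi (0 : ℝ)),
          ‖(((r : ℝ) ^ θ : ℝ) : 𝕜) • G (r + s) u‖ ≤ C * s ^ e * ∏ i, ‖u i‖ := fun u r => by
        rw [norm_rpow_smul r.2]
        exact hG r s r.2 hs u
      let Γ₀ : MultilinearMap 𝕜 (fun _ : Fin p => E) (Ioi (0 : ℝ) →ᵇ E) :=
        { toFun := fun u => BoundedContinuousFunction.ofNormedAddCommGroup
            (fun r : Ioi (0 : ℝ) => (((r : ℝ) ^ θ : ℝ) : 𝕜) • G (r + s) u)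
            (continuous_rpow_smul_shift (x := fun t => G t u)
              (continuousOn_of_semigroup hS fun r s hr hs => hSG r s hr hs u) hs)
            (C * s ^ e * ∏ i, ‖u i‖) (hbd u)
          map_update_add' := fun m i x y => by
            ext r
            simp only [BoundedContinuousFunction.coe_ofNormedAddCommGroup,
              ContinuousMultilinearMap.map_update_add, smul_add,
              BoundedContinuousFunction.coe_add, Pi.add_apply]
          map_update_smul' := fun m i c x => by
            ext r
            simp only [BoundedContinuousFunction.coe_ofNormedAddCommGroup,
              ContinuousMultilinearMap.map_update_smul, BoundedContinuousFunction.coe_smul]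
            rw [smul_comm] }
      have hΓ : ∀ u, ‖Γ₀ u‖ ≤ C * s ^ e * ∏ i, ‖u i‖ := fun u =>
        BoundedContinuousFunction.norm_ofNormedAddCommGroup_le _ (by positivity) (hbd u)
      exact ⟨Γ₀.mkContinuous _ hΓ, fun _ =>
        ⟨MultilinearMap.mkContinuous_norm_le _ (by positivity) _, fun _ _ => rfl⟩⟩
    · exact ⟨0, fun h => absurd h hs⟩
  choose Γ hΓ using hex
  refine ⟨Γ, ?_, fun s hs => (hΓ s hs).1, fun s hs => (hΓ s hs).2⟩
  refine continuousOn_of_norm_sub_le hS fun s₀ hs₀ => ⟨C * s₀ ^ e, fun s s' hs hs' => ?_⟩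
  refine ContinuousMultilinearMap.opNorm_le_bound (by positivity) fun u => ?_
  rw [BoundedContinuousFunction.norm_le (by positivity)]
  intro r
  have hr : (0 : ℝ) < r := r.2
  have e1 := hSG (s - s₀) (r + s₀) (sub_pos.2 hs) (add_pos hr hs₀) u
  have e2 := hSG (s' - s₀) (r + s₀) (sub_pos.2 hs') (add_pos hr hs₀) u
  rw [show s - s₀ + (r + s₀) = r + s by ring] at e1
  rw [show s' - s₀ + (r + s₀) = r + s' by ring] at e2
  rw [sub_apply, BoundedContinuousFunction.sub_apply,
    (hΓ s (hs₀.trans hs)).2, (hΓ s' (hs₀.trans hs')).2,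
    ← smul_sub, norm_rpow_smul hr, ← e1, ← e2, ← sub_apply]
  calc _ ≤ (r : ℝ) ^ θ * (‖S (s - s₀) - S (s' - s₀)‖ * ‖G (r + s₀) u‖) := by
        gcongr
        exact ContinuousLinearMap.le_opNorm _ _
    _ = ((r : ℝ) ^ θ * ‖G (r + s₀) u‖) * ‖S (s - s₀) - S (s' - s₀)‖ := by ring
    _ ≤ (C * s₀ ^ e * ∏ i, ‖u i‖) * ‖S (s - s₀) - S (s' - s₀)‖ := by
        exact mul_le_mul_of_nonneg_right (hG r s₀ hr hs₀ u) (norm_nonneg _)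
    _ = _ := by ring

end Orbits

end FracHeat

namespace FracHeat

open scoped BoundedContinuousFunction

section MildSystem

variable {𝕜 : Type*} [RCLike 𝕜] {E : Type*} [NormedAddCommGroup E] [NormedSpace 𝕜 E] {p : ℕ}
  {S : ℝ → E →L[𝕜] E} {G : ℝ → ContinuousMultilinearMap 𝕜 (fun _ : Fin p => E) E}
  {θ C₁ C₂ κ₁ κ₂ M R : ℝ}

/-- A norm-continuous semigroup `S` on `E` together with the smoothed forms `G(s) = S(s)B`,
which satisfy the two basic estimates. -/
structure MildSystem (S : ℝ → E →L[𝕜] E)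
    (G : ℝ → ContinuousMultilinearMap 𝕜 (fun _ : Fin p => E) E) (θ C₁ C₂ : ℝ) : Prop where
  pos : 0 < θ
  one_lt : 1 < p
  lt_one : p * θ < 1
  nonneg : 0 ≤ C₁ ∧ 0 ≤ C₂
  continuousOn : ContinuousOn S (Ioi 0)
  comp_form : ∀ r s, 0 < r → 0 < s → ∀ u, S r (G s u) = G (r + s) u
  bound : ∀ s, 0 < s → ‖G s‖ ≤ C₁ * s ^ (p * θ - θ - 1)
  bound_orbit : ∀ r s, 0 < r → 0 < s → ∀ u : Fin p → E,
    r ^ θ * ‖G (r + s) u‖ ≤ C₂ * s ^ (p * θ - 1) * ∏ i, ‖u i‖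

namespace MildSystem

theorem exp_gt (hS : MildSystem S G θ C₁ C₂) : -1 < p * θ - θ - 1 ∧ -1 < p * θ - 1 := by
  have h1 := hS.pos
  have h2 : (1 : ℝ) < p := by exact_mod_cast hS.one_lt
  constructor <;> nlinarith

theorem le_of_rpow_mul_le {t a b : ℝ} (ht : 0 < t) (h : t ^ θ * a ≤ b) : a ≤ b * t ^ (-θ) := by
  rw [Real.rpow_neg ht.le, ← div_eq_mul_inv, le_div_iff₀ (by positivity)]
  linarith

theorem rpow_mul_le_of_le {t a b : ℝ} (ht : 0 < t) (h : a ≤ b * t ^ (-θ)) : t ^ θ * a ≤ b := by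
  rw [Real.rpow_neg ht.le, ← div_eq_mul_inv, le_div_iff₀ (by positivity)] at h
  linarith

variable [NormedSpace ℝ E]

theorem exists_solution [CompleteSpace E] (hS : MildSystem S G θ C₁ C₂)
    (hκ₁ : κ₁ = C₁ * ∫ σ in Ioo (0 : ℝ) 1, (1 - σ) ^ (p * θ - θ - 1) * σ ^ (-(p * θ)))
    (hκ₂ : κ₂ = C₂ * ∫ σ in Ioo (0 : ℝ) 1, (1 - σ) ^ (p * θ - 1) * σ ^ (-(p * θ)))
    (hM : 0 ≤ M) (hball : R + κ₁ * M ^ p ≤ M) (hq : p * κ₁ * M ^ (p - 1) < 1)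
    {y : ℝ → E} (hy : ∀ r s, 0 < r → 0 < s → S r (y s) = y (r + s))
    (hyR : ∀ t, 0 < t → t ^ θ * ‖y t‖ ≤ R) :
    ∃ (u : ℝ → E) (U : ℝ → (Ioi (0 : ℝ) →ᵇ E)), ContinuousOn U (Ioi 0) ∧
      ∀ t, 0 < t → IntegrableOn (fun τ => G (t - τ) fun _ => u τ) (Ioo 0 t) ∧
        u t = y t + duhamel G u t ∧ t ^ θ * ‖u t‖ ≤ R + κ₁ * M ^ p ∧ ‖U t‖ ≤ R + κ₂ * M ^ p ∧
        ∀ r : Ioi (0 : ℝ), U t r = (((r : ℝ) ^ θ : ℝ) : 𝕜) • S r (u t) := by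
  have hp : 1 ≤ p := hS.one_lt.le
  have hGc := continuousOn_form_of_semigroup hS.continuousOn hS.comp_form
  obtain ⟨u, huc, hub, hu⟩ := exists_mild_solution hS.exp_gt.1 hS.lt_one hp hGc hS.bound
    (continuousOn_of_semigroup hS.continuousOn hy)
    (fun t ht => le_of_rpow_mul_le ht (hyR t ht)) hM hκ₁ hball hq
  have hint : ∀ t, 0 < t → IntegrableOn (fun τ => G (t - τ) fun _ => u τ) (Ioo 0 t) :=
    fun t ht => integrableOn_form hS.exp_gt.1 hS.lt_one hGc hS.bound huc hub ht
  obtain ⟨Y, hYc, hY⟩ := exists_orbit hS.continuousOn hS.pos hy hyR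
  obtain ⟨Γ, hΓc, hΓ, hΓG⟩ := exists_orbit_form hS.continuousOn hS.nonneg.2 hS.comp_form
    hS.bound_orbit
  refine ⟨u, fun t => Y t + duhamel Γ u t, hYc.add
    (continuousOn_duhamel hS.exp_gt.2 hS.lt_one hΓc hΓ hM huc hub), fun t ht => ⟨hint t ht,
    hu t ht, ?_, ?_, fun r => ?_⟩⟩
  · have h1 := norm_duhamel_le hS.exp_gt.1 hS.lt_one hS.bound hub ht
    refine rpow_mul_le_of_le ht ?_
    rw [hu t ht]
    have h2 := le_of_rpow_mul_le ht (hyR t ht)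
    rw [show p * θ - θ - 1 + -(p * θ) + 1 = -θ by ring] at h1
    refine (norm_add_le _ _).trans ((add_le_add h2 h1).trans (le_of_eq ?_))
    rw [hκ₁]; ring
  · have h1 := norm_duhamel_le hS.exp_gt.2 hS.lt_one hΓ hub ht
    rw [show p * θ - 1 + -(p * θ) + 1 = 0 by ring, Real.rpow_zero, one_mul] at h1
    refine (norm_add_le _ _).trans ((add_le_add (hY t ht).1 h1).trans (le_of_eq ?_))
    rw [hκ₂]; ring
  · have hr : (0 : ℝ) < r := r.2
    have hΓi := integrableOn_form hS.exp_gt.2 hS.lt_one hΓc hΓ huc hub ht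
    have h1 : duhamel Γ u t r = (((r : ℝ) ^ θ : ℝ) : 𝕜) • S r (duhamel G u t) := by
      rw [duhamel, duhamel, ← ContinuousLinearMap.integral_comp_comm _ (hint t ht),
        ← integral_smul]
      refine ((BoundedContinuousFunction.evalCLM 𝕜 r).integral_comp_comm hΓi).symm.trans ?_
      refine setIntegral_congr_fun measurableSet_Ioo fun τ hτ => ?_
      have h2 := hΓG (t - τ) (sub_pos.2 hτ.2) (fun _ => u τ) r
      have h3 := hS.comp_form r (t - τ) hr (sub_pos.2 hτ.2) fun _ => u τ
      simp only [BoundedContinuousFunction.evalCLM_apply]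
      rw [h2, h3]
    change Y t r + duhamel Γ u t r = _
    rw [(hY t ht).2, h1, hu t ht, map_add, smul_add, hy r t hr ht]

section Difference

variable {u v y z : ℝ → E}
  (hui : ∀ t, 0 < t → IntegrableOn (fun τ => G (t - τ) fun _ => u τ) (Ioo 0 t))
  (hvi : ∀ t, 0 < t → IntegrableOn (fun τ => G (t - τ) fun _ => v τ) (Ioo 0 t))
  (hu : ∀ t, 0 < t → u t = y t + duhamel G u t) (hv : ∀ t, 0 < t → v t = z t + duhamel G v t)
  (huM : ∀ t, 0 < t → t ^ θ * ‖u t‖ ≤ M) (hvM : ∀ t, 0 < t → t ^ θ * ‖v t‖ ≤ M)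

include hui hvi hu hv huM hvM

theorem weighted_norm_sub_le (hS : MildSystem S G θ C₁ C₂)
    (hκ₁ : κ₁ = C₁ * ∫ σ in Ioo (0 : ℝ) 1, (1 - σ) ^ (p * θ - θ - 1) * σ ^ (-(p * θ)))
    {D : ℝ} (hD : ∀ t, 0 < t → t ^ θ * ‖u t - v t‖ ≤ D) {t : ℝ} (ht : 0 < t) :
    t ^ θ * ‖u t - v t‖ ≤ t ^ θ * ‖y t - z t‖ + p * κ₁ * M ^ (p - 1) * D := by
  have h1 := norm_duhamel_sub_le hS.exp_gt.1 hS.lt_one hS.one_lt.le hS.bound ht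
    (fun τ hτ => le_of_rpow_mul_le hτ (huM τ hτ)) (fun τ hτ => le_of_rpow_mul_le hτ (hvM τ hτ))
    (fun τ hτ => le_of_rpow_mul_le hτ (hD τ hτ)) (hui t ht) (hvi t ht)
  rw [show p * θ - θ - 1 + -(p * θ) + 1 = -θ by ring, ← hκ₁] at h1
  have h2 := rpow_mul_le_of_le ht h1
  rw [hu t ht, hv t ht, add_sub_add_comm]
  calc _ ≤ t ^ θ * (‖y t - z t‖ + ‖duhamel G u t - duhamel G v t‖) := by
        gcongr
        exact norm_add_le _ _
    _ ≤ _ := by rw [mul_add]; gcongr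

theorem weighted_norm_orbit_sub_le [CompleteSpace E] (hS : MildSystem S G θ C₁ C₂)
    (hκ₂ : κ₂ = C₂ * ∫ σ in Ioo (0 : ℝ) 1, (1 - σ) ^ (p * θ - 1) * σ ^ (-(p * θ)))
    (hy : ∀ r s, 0 < r → 0 < s → S r (y s) = y (r + s))
    (hz : ∀ r s, 0 < r → 0 < s → S r (z s) = z (r + s))
    {D : ℝ} (hD : ∀ t, 0 < t → t ^ θ * ‖u t - v t‖ ≤ D) {r t : ℝ} (hr : 0 < r) (ht : 0 < t) :
    r ^ θ * ‖S r (u t - v t)‖ ≤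
      r ^ θ * ‖y (r + t) - z (r + t)‖ + p * κ₂ * M ^ (p - 1) * D := by
  set H : ℝ → ContinuousMultilinearMap 𝕜 (fun _ : Fin p => E) E :=
    fun s => ((r ^ θ : ℝ) : 𝕜) • G (r + s) with hH
  have hHb : ∀ s, 0 < s → ‖H s‖ ≤ C₂ * s ^ (p * θ - 1) := fun s hs => by
    refine ContinuousMultilinearMap.opNorm_le_bound
      (mul_nonneg hS.nonneg.2 (Real.rpow_nonneg hs.le _)) fun w => ?_
    have : H s w = ((r ^ θ : ℝ) : 𝕜) • G (r + s) w := rfl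
    rw [this, norm_rpow_smul hr]
    exact hS.bound_orbit r s hr hs w
  have hHG : ∀ (w : ℝ → E), ∀ τ ∈ Ioo 0 t,
      ((r ^ θ : ℝ) : 𝕜) • S r (G (t - τ) fun _ => w τ) = H (t - τ) fun _ => w τ := fun w τ hτ => by
    rw [hS.comp_form r _ hr (sub_pos.2 hτ.2)]
    rfl
  have hHi : ∀ w : ℝ → E, IntegrableOn (fun τ => G (t - τ) fun _ => w τ) (Ioo 0 t) →
      IntegrableOn (fun τ => H (t - τ) fun _ => w τ) (Ioo 0 t) := fun w hw =>
    IntegrableOn.congr_fun (((S r).integrable_comp hw).smul ((r ^ θ : ℝ) : 𝕜)) (hHG w)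
      measurableSet_Ioo
  have hHd : ∀ w : ℝ → E, IntegrableOn (fun τ => G (t - τ) fun _ => w τ) (Ioo 0 t) →
      duhamel H w t = ((r ^ θ : ℝ) : 𝕜) • S r (duhamel G w t) := fun w hw => by
    rw [duhamel, duhamel, ← ContinuousLinearMap.integral_comp_comm _ hw, ← integral_smul]
    exact (setIntegral_congr_fun measurableSet_Ioo (hHG w)).symm
  have h1 := norm_duhamel_sub_le hS.exp_gt.2 hS.lt_one hS.one_lt.le hHb ht
    (fun τ hτ => le_of_rpow_mul_le hτ (huM τ hτ)) (fun τ hτ => le_of_rpow_mul_le hτ (hvM τ hτ))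
    (fun τ hτ => le_of_rpow_mul_le hτ (hD τ hτ)) (hHi u (hui t ht)) (hHi v (hvi t ht))
  rw [show p * θ - 1 + -(p * θ) + 1 = 0 by ring, Real.rpow_zero, mul_one, ← hκ₂,
    hHd u (hui t ht), hHd v (hvi t ht), ← smul_sub, norm_rpow_smul hr] at h1
  rw [hu t ht, hv t ht, add_sub_add_comm, map_add, map_sub, map_sub, hy r t hr ht, hz r t hr ht]
  calc _ ≤ r ^ θ * (‖y (r + t) - z (r + t)‖ + ‖S r (duhamel G u t) - S r (duhamel G v t)‖) := by
        gcongr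
        exact norm_add_le _ _
    _ ≤ _ := by rw [mul_add]; gcongr

theorem tendsto_sub_iff (hS : MildSystem S G θ C₁ C₂)
    (hκ₁ : κ₁ = C₁ * ∫ σ in Ioo (0 : ℝ) 1, (1 - σ) ^ (p * θ - θ - 1) * σ ^ (-(p * θ)))
    (hq : p * κ₁ * M ^ (p - 1) < 1) :
    Tendsto (fun t => t ^ θ * ‖u t - v t‖) atTop (𝓝 0) ↔
      Tendsto (fun t => t ^ θ * ‖y t - z t‖) atTop (𝓝 0) := by
  have hg0 : ∀ t, 0 < t → 0 ≤ t ^ θ * ‖u t - v t‖ := fun t ht => by positivity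
  refine tendsto_zero_iff_of_average_bound (N := 2 * M)
    (w := fun σ => p * C₁ * M ^ (p - 1) * ((1 - σ) ^ (p * θ - θ - 1) * σ ^ (-(p * θ))))
    hg0 (fun t ht => ?_)
    ((integrableOn_beta hS.exp_gt.1 (by linarith [hS.lt_one])).const_mul _) ?_ ?_
  · calc _ ≤ t ^ θ * (‖u t‖ + ‖v t‖) := by gcongr; exact norm_sub_le _ _
      _ ≤ _ := by linarith [huM t ht, hvM t ht]
  · rw [integral_const_mul]
    refine lt_of_eq_of_lt ?_ hq
    rw [hκ₁]; ring
  · intro h hanti hgh hhN t ht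
    have h1 := norm_duhamel_sub_le_integral (N := 2 * M) hS.exp_gt.1 hS.lt_one hS.one_lt.le
      hS.bound ht (fun τ hτ => le_of_rpow_mul_le hτ (huM τ hτ))
      (fun τ hτ => le_of_rpow_mul_le hτ (hvM τ hτ))
      (fun τ hτ => le_of_rpow_mul_le hτ (hgh τ hτ)) hanti (fun τ hτ => by
        rw [Real.norm_of_nonneg ((hg0 τ hτ).trans (hgh τ hτ))]
        exact hhN τ hτ) (hui t ht) (hvi t ht)
    rw [show p * θ - θ - 1 + -(p * θ) + 1 = -θ by ring, mul_comm (t ^ (-θ))] at h1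
    refine le_trans ?_ (rpow_mul_le_of_le ht h1)
    rw [← mul_sub, abs_mul, abs_of_nonneg (Real.rpow_nonneg ht.le _)]
    gcongr
    have h2 : duhamel G u t - duhamel G v t = (u t - v t) - (y t - z t) := by
      rw [hu t ht, hv t ht]; abel
    rw [h2]
    exact abs_norm_sub_norm_le _ _

end Difference

end MildSystem

end MildSystem

end FracHeat

namespace FracHeat

section ENNRealBounds

variable {E : Type*} [NormedAddCommGroup E]

theorem ofReal_mul_enorm_eq {a : ℝ} (ha : 0 ≤ a) (x : E) :
    ENNReal.ofReal a * ‖x‖ₑ = ENNReal.ofReal (a * ‖x‖) := by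
  rw [ENNReal.ofReal_mul ha, ofReal_norm]

theorem ofReal_mul_enorm_le_iff {a b : ℝ} (ha : 0 ≤ a) (hb : 0 ≤ b) (x : E) :
    ENNReal.ofReal a * ‖x‖ₑ ≤ ENNReal.ofReal b ↔ a * ‖x‖ ≤ b := by
  rw [ofReal_mul_enorm_eq ha, ENNReal.ofReal_le_ofReal_iff hb]

theorem tendsto_ofReal_zero_iff {ι : Type*} {l : Filter ι} {f : ι → ℝ} (hf : ∀ᶠ i in l, 0 ≤ f i) :
    Tendsto (fun i => ENNReal.ofReal (f i)) l (𝓝 0) ↔ Tendsto f l (𝓝 0) := by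
  constructor
  · intro h
    have h1 := (ENNReal.tendsto_toReal ENNReal.zero_ne_top).comp h
    rw [ENNReal.toReal_zero] at h1
    refine h1.congr' ?_
    filter_upwards [hf] with i hi
    exact ENNReal.toReal_ofReal hi
  · intro h
    simpa using ENNReal.tendsto_ofReal h

end ENNRealBounds

section HeatNorm

variable {𝕜 : Type*} [RCLike 𝕜] {n : ℕ} {E : Type*} [NormedAddCommGroup E] [NormedSpace 𝕜 E]
  {β α : ℝ} {ι : E →L[𝕜] Distr n 𝕜}

theorem heatNorm_eq (hι : Function.Injective ι) {t : ℝ} {u : Distr n 𝕜} {e : E}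
    (h : IsHeat β t u (ι e)) : heatNorm β ι t u = ‖e‖ₑ := by
  refine le_antisymm (iInf₂_le e h) (le_iInf₂ fun e' h' => ?_)
  rw [hι (IsConv.unique h h')]

theorem exists_isHeat_of_heatNorm_lt_top {t : ℝ} {u : Distr n 𝕜} (h : heatNorm β ι t u < ∞) :
    ∃ e : E, IsHeat β t u (ι e) := by
  by_contra hne
  push Not at hne
  refine h.ne ?_
  rw [heatNorm]
  simp [hne]

theorem BENorm_eq (hι : Function.Injective ι) {u : Distr n 𝕜} {y : ℝ → E}
    (h : ∀ t, 0 < t → IsHeat β t u (ι (y t))) :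
    BENorm β α ι u = ⨆ (t : ℝ) (_ : 0 < t), ENNReal.ofReal (t ^ (α / β) * ‖y t‖) := by
  unfold BENorm
  refine iSup_congr fun t => iSup_congr fun ht => ?_
  rw [heatNorm_eq hι (h t ht), ofReal_mul_enorm_eq (Real.rpow_nonneg ht.le _)]

theorem BENorm_le_iff (hι : Function.Injective ι) {u : Distr n 𝕜} {y : ℝ → E}
    (h : ∀ t, 0 < t → IsHeat β t u (ι (y t))) {R : ℝ} (hR : 0 ≤ R) :
    BENorm β α ι u ≤ ENNReal.ofReal R ↔ ∀ t, 0 < t → t ^ (α / β) * ‖y t‖ ≤ R := by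
  rw [BENorm_eq hι h]
  simp only [iSup_le_iff, ENNReal.ofReal_le_ofReal_iff hR]

theorem exists_heat_orbit {u : Distr n 𝕜} (h : BENorm β α ι u < ∞) :
    ∃ y : ℝ → E, ∀ t, 0 < t → IsHeat β t u (ι (y t)) := by
  have : ∀ t : ℝ, ∃ e : E, 0 < t → IsHeat β t u (ι e) := by
    intro t
    by_cases ht : 0 < t
    · have h1 : ENNReal.ofReal (t ^ (α / β)) * heatNorm β ι t u < ∞ :=
        lt_of_le_of_lt (le_iSup₂ (f := fun (t : ℝ) (_ : 0 < t) =>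
          ENNReal.ofReal (t ^ (α / β)) * heatNorm β ι t u) t ht) h
      have h2 : ENNReal.ofReal (t ^ (α / β)) ≠ 0 := by
        rw [Ne, ENNReal.ofReal_eq_zero, not_le]
        positivity
      obtain ⟨e, he⟩ := exists_isHeat_of_heatNorm_lt_top (β := β) (ι := ι) (t := t) (u := u) (by
        by_contra hne
        rw [not_lt, top_le_iff] at hne
        rw [hne, ENNReal.mul_top h2] at h1
        exact lt_irrefl _ h1)
      exact ⟨e, fun _ => he⟩
    · exact ⟨0, fun h => absurd h ht⟩
  choose y hy using this
  exact ⟨y, hy⟩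

end HeatNorm

section Operators

variable {𝕜 : Type*} [RCLike 𝕜] {n : ℕ} {E : Type*} [NormedAddCommGroup E] [NormedSpace 𝕜 E]
  {p : ℕ} {β a σ α : ℝ} {ι : E →L[𝕜] Distr n 𝕜}
  {B : MultilinearMap 𝕜 (fun _ : Fin p => E) (Distr n 𝕜)}

/-- `S_β(t)` acts on `E` by bounded operators that depend continuously on `t > 0`. -/
theorem Adequate.exists_heat_operator (hβ : 0 < β) (hA : Adequate β ι B) :
    ∃ S : ℝ → E →L[𝕜] E, ContinuousOn S (Ioi 0) ∧
      ∀ t, 0 < t → ∀ u, IsHeat β t (ι u) (ι (S t u)) := by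
  have hι := hA.injective
  have hex : ∀ t : ℝ, ∃ S : E →L[𝕜] E, 0 < t → ∀ u, IsHeat β t (ι u) (ι (S u)) := by
    intro t
    by_cases ht : 0 < t
    · have hk := integrable_kernel (n := n) hβ ht
      choose L hL hLb using fun u : E => hA.convolution u _ hk
      let L₀ : E →ₗ[𝕜] E :=
        { toFun := L
          map_add' := fun u v => hι (by
            rw [map_add]
            have := IsConv.add hk (hL u) (hL v)
            rw [← map_add] at this
            exact (hL (u + v)).unique this)
          map_smul' := fun c u => hι (by
            have := (hL u).smul c
            rw [← map_smul] at this
            rw [RingHom.id_apply, map_smul]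
            exact (hL (c • u)).unique this) }
      exact ⟨L₀.mkContinuous _ hLb, fun _ u => hL u⟩
    · exact ⟨0, fun h => absurd h ht⟩
  choose S hS using hex
  refine ⟨S, fun s hs => ContinuousAt.continuousWithinAt ?_, hS⟩
  have hs0 : (0 : ℝ) < s := hs
  rw [ContinuousAt, tendsto_iff_norm_sub_tendsto_zero]
  refine squeeze_zero' (Eventually.of_forall fun _ => norm_nonneg _) ?_
    (tendsto_integral_abs_kernel_sub (n := n) hβ hs0)
  filter_upwards [lt_mem_nhds hs0] with t ht
  refine ContinuousLinearMap.opNorm_le_bound _ (integral_nonneg fun _ => abs_nonneg _) fun u => ?_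
  have hkt := integrable_kernel (n := n) hβ ht
  have hks := integrable_kernel (n := n) hβ hs0
  obtain ⟨v, hv, hvb⟩ := hA.convolution u _ (hkt.sub hks)
  have h1 := IsConv.sub_left hkt hks (hS t ht u) (hS s hs0 u)
  rw [← map_sub] at h1
  have h2 : S t u - S s u = v := hι (h1.unique hv)
  rw [sub_apply, h2]
  exact hvb

theorem EstimateE.exists_form (hβ : 0 < β) (hι : Function.Injective ι) {C₁ : ℝ} (hC : 0 ≤ C₁)
    (hE : EstimateE β a σ ι B C₁) :
    ∃ G : ℝ → ContinuousMultilinearMap 𝕜 (fun _ : Fin p => E) E, ∀ t, 0 < t →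
      ‖G t‖ ≤ C₁ * t ^ ((((p : ℝ) - 1) * a - σ) / β) ∧ ∀ u, IsHeat β t (B u) (ι (G t u)) := by
  have hex : ∀ t : ℝ, ∃ G : ContinuousMultilinearMap 𝕜 (fun _ : Fin p => E) E, 0 < t →
      ‖G‖ ≤ C₁ * t ^ ((((p : ℝ) - 1) * a - σ) / β) ∧ ∀ u, IsHeat β t (B u) (ι (G u)) := by
    intro t
    by_cases ht : 0 < t
    · choose g hg using fun u : Fin p → E => exists_isHeat_of_heatNorm_lt_top
        ((hE t ht u).trans_lt ENNReal.ofReal_lt_top)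
      have hb : ∀ u, ‖g u‖ ≤ C₁ * t ^ ((((p : ℝ) - 1) * a - σ) / β) * ∏ i, ‖u i‖ := fun u => by
        have h1 := hE t ht u
        rw [heatNorm_eq hι (hg u), ← ofReal_norm,
          ENNReal.ofReal_le_ofReal_iff (by positivity)] at h1
        exact h1
      let G₀ : MultilinearMap 𝕜 (fun _ : Fin p => E) E :=
        { toFun := g
          map_update_add' := fun m i x y => hι (by
            have h1 := (hg (Function.update m i (x + y)))
            rw [MultilinearMap.map_update_add] at h1
            have h2 := (hg (Function.update m i x)).add hβ ht (hg (Function.update m i y))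
            rw [map_add]
            exact IsConv.unique h1 h2)
          map_update_smul' := fun m i c x => hι (by
            have h1 := (hg (Function.update m i (c • x)))
            rw [MultilinearMap.map_update_smul] at h1
            have h2 := IsConv.smul (hg (Function.update m i x)) c
            rw [map_smul]
            exact IsConv.unique h1 h2) }
      exact ⟨G₀.mkContinuous _ hb, fun _ =>
        ⟨MultilinearMap.mkContinuous_norm_le _ (by positivity) _, hg⟩⟩
    · exact ⟨0, fun h => absurd h ht⟩
  choose G hG using hex
  exact ⟨G, hG⟩

/-- The first basic estimate, by scaling from `t = 1`. -/
theorem Adequate.exists_estimateE (hβ : 0 < β) (hA : Adequate β ι B) (hE : SpaceScaling ι a)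
    (hB : FormScaling ι B σ) : ∃ C₁, 0 < C₁ ∧ EstimateE β a σ ι B C₁ := by
  obtain ⟨ω, hω, -, hωB⟩ := hA.form_bound
  have hι := hA.injective
  refine ⟨ω 1, hω 1 one_pos, fun t ht u => ?_⟩
  set lam : ℝ := t ^ (-β⁻¹) with hlam_def
  have hlam : 0 < lam := Real.rpow_pos_of_pos ht _
  have hlami : 0 < lam⁻¹ := inv_pos.2 hlam
  choose v hv hvn using fun i => hE (u i) lam⁻¹ hlami
  obtain ⟨e, he⟩ := exists_isHeat_of_heatNorm_lt_top
    ((hωB 1 one_pos v).trans_lt ENNReal.ofReal_lt_top)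
  have heb : ‖e‖ ≤ ω 1 * ∏ i, ‖v i‖ := by
    have h1 := hωB 1 one_pos v
    have h2 := hω 1 one_pos
    rwa [heatNorm_eq hι he, ← ofReal_norm,
      ENNReal.ofReal_le_ofReal_iff (by positivity)] at h1
  obtain ⟨e', he', hen⟩ := hE e lam hlam
  have hBu := hB lam hlam v u fun i => by
    rw [hv i, dilate_inv_dilate hlam hlami (mul_inv_cancel₀ hlam.ne')]
  have hheat : IsHeat β t (B u) (ι (((lam ^ σ : ℝ) : 𝕜) • e')) := by
    rw [hBu, map_smul, he']
    refine IsConv.smul ?_ _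
    have := he.dilate hlam
    have e1 : lam ^ (-β) * 1 = t := by rw [mul_one, hlam_def, rpow_inv_neg hβ ht]
    rwa [e1] at this
  rw [heatNorm_eq hι hheat, ← ofReal_norm]
  refine ENNReal.ofReal_le_ofReal ?_
  rw [norm_smul, RCLike.norm_ofReal, abs_of_pos (Real.rpow_pos_of_pos hlam _), hen]
  have hpow : t ^ ((((p : ℝ) - 1) * a - σ) / β) = lam ^ σ * lam ^ a * (lam⁻¹ ^ a) ^ p := by
    rw [Real.inv_rpow hlam.le, ← Real.rpow_neg hlam.le, ← Real.rpow_natCast,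
      ← Real.rpow_mul hlam.le, ← Real.rpow_add hlam, ← Real.rpow_add hlam, hlam_def,
      ← Real.rpow_mul ht.le]
    congr 1
    field_simp
    ring
  calc lam ^ σ * (lam ^ a * ‖e‖) ≤ lam ^ σ * (lam ^ a * (ω 1 * ∏ i, ‖v i‖)) := by gcongr
    _ = _ := by
      simp only [hvn]
      rw [Finset.prod_mul_distrib, Finset.prod_const, Finset.card_univ, Fintype.card_fin, hpow]
      ring

/-- `S` and `G` realize `S_β(t)` and `S_β(t)B` as maps with values in `E`. -/
structure IsRealization (β : ℝ) (ι : E →L[𝕜] Distr n 𝕜)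
    (B : MultilinearMap 𝕜 (fun _ : Fin p => E) (Distr n 𝕜)) (S : ℝ → E →L[𝕜] E)
    (G : ℝ → ContinuousMultilinearMap 𝕜 (fun _ : Fin p => E) E) : Prop where
  pos : 0 < β
  injective : Function.Injective ι
  heat : ∀ t, 0 < t → ∀ u, IsHeat β t (ι u) (ι (S t u))
  form : ∀ t, 0 < t → ∀ u, IsHeat β t (B u) (ι (G t u))

variable {S : ℝ → E →L[𝕜] E} {G : ℝ → ContinuousMultilinearMap 𝕜 (fun _ : Fin p => E) E}

theorem IsRealization.orbit (h : IsRealization β ι B S G) {u₀ : Distr n 𝕜} {y : ℝ → E}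
    (hy : ∀ t, 0 < t → IsHeat β t u₀ (ι (y t))) (r s : ℝ) (hr : 0 < r) (hs : 0 < s) :
    S r (y s) = y (r + s) :=
  h.injective (IsConv.unique ((hy s hs).comp h.pos hr hs (h.heat r hr (y s)))
    (hy (r + s) (add_pos hr hs)))

theorem IsRealization.comp_form (h : IsRealization β ι B S G) (r s : ℝ) (hr : 0 < r) (hs : 0 < s)
    (u : Fin p → E) : S r (G s u) = G (r + s) u :=
  h.orbit (u₀ := B u) (y := fun t => G t u) (fun t ht => h.form t ht u) r s hr hs

theorem IsRealization.estimateBE (h : IsRealization β ι B S G) {C₁ : ℝ} (hC : 0 ≤ C₁)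
    (hG : ∀ t, 0 < t → ‖G t‖ ≤ C₁ * t ^ ((((p : ℝ) - 1) * a - σ) / β)) (hα : 0 ≤ α)
    (hneg : α + ((p : ℝ) - 1) * a - σ ≤ 0) : EstimateBE β a σ α ι B C₁ := by
  have hβ := h.pos
  intro t ht u
  refine ⟨ι (G t u), h.form t ht u, ?_⟩
  rw [BENorm_le_iff h.injective (fun r hr => h.heat r hr (G t u)) (by positivity)]
  intro r hr
  rw [h.comp_form r t hr ht]
  have hrt : 0 < r + t := add_pos hr ht
  have h1 : r ^ (α / β) ≤ (r + t) ^ (α / β) := by gcongr; linarith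
  have h2 : (r + t) ^ ((α + ((p : ℝ) - 1) * a - σ) / β) ≤
      t ^ ((α + ((p : ℝ) - 1) * a - σ) / β) :=
    Real.rpow_le_rpow_of_nonpos ht (by linarith) (div_nonpos_of_nonpos_of_nonneg hneg hβ.le)
  calc r ^ (α / β) * ‖G (r + t) u‖
      ≤ (r + t) ^ (α / β) * (C₁ * (r + t) ^ ((((p : ℝ) - 1) * a - σ) / β) * ∏ i, ‖u i‖) := by
        gcongr
        exact ((G (r + t)).le_opNorm u).trans (by gcongr; exact hG _ hrt)
    _ = C₁ * ((r + t) ^ (α / β) * (r + t) ^ ((((p : ℝ) - 1) * a - σ) / β)) * ∏ i, ‖u i‖ := by ring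
    _ = C₁ * (r + t) ^ ((α + ((p : ℝ) - 1) * a - σ) / β) * ∏ i, ‖u i‖ := by
        rw [← Real.rpow_add hrt]
        congr 3
        ring
    _ ≤ _ := by gcongr

theorem IsRealization.mildSystem (h : IsRealization β ι B S G) (hS : ContinuousOn S (Ioi 0))
    {C₁ C₂ θ : ℝ} (hC₁ : 0 ≤ C₁) (hC₂ : 0 ≤ C₂) (hp : 1 < p) (hθ : 0 < θ) (hpθ : p * θ < 1)
    (hα : α / β = θ) (e₁ : (((p : ℝ) - 1) * a - σ) / β = p * θ - θ - 1)
    (e₂ : (α + ((p : ℝ) - 1) * a - σ) / β = p * θ - 1)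
    (hG : ∀ t, 0 < t → ‖G t‖ ≤ C₁ * t ^ ((((p : ℝ) - 1) * a - σ) / β))
    (hBE : EstimateBE β a σ α ι B C₂) : MildSystem S G θ C₁ C₂ where
  pos := hθ
  one_lt := hp
  lt_one := hpθ
  nonneg := ⟨hC₁, hC₂⟩
  continuousOn := hS
  comp_form := h.comp_form
  bound t ht := by rw [← e₁]; exact hG t ht
  bound_orbit r s hr hs u := by
    obtain ⟨w, hw, hwb⟩ := hBE s hs u
    obtain rfl : w = ι (G s u) := IsConv.unique hw (h.form s hs u)
    rw [BENorm_le_iff h.injective (fun r hr => h.heat r hr (G s u)) (by positivity)] at hwb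
    have := hwb r hr
    rwa [h.comp_form r s hr hs, hα, e₂] at this

end Operators

end FracHeat

namespace FracHeat

open scoped BoundedContinuousFunction

section Constants

theorem exponent_identities {p : ℕ} (hp : 1 < p) {β a σ α : ℝ} (hβ : 0 < β)
    (h₁ : (β - σ) / ((p : ℝ) - 1) - β / p < -a) (h₂ : -a < (β - σ) / ((p : ℝ) - 1))
    (hα : α = (β - σ) / ((p : ℝ) - 1) + a) :
    0 < α / β ∧ p * (α / β) < 1 ∧ (((p : ℝ) - 1) * a - σ) / β = p * (α / β) - α / β - 1 ∧
      (α + ((p : ℝ) - 1) * a - σ) / β = p * (α / β) - 1 := by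
  have hp1 : (1 : ℝ) < p := by exact_mod_cast hp
  have hp0 : (0 : ℝ) < p := by linarith
  have hα' : (p - 1) * α = β - σ + (p - 1) * a := by
    rw [hα, mul_add, mul_div_cancel₀ _ (by linarith)]
  have hlt : α < β / p := by linarith
  rw [lt_div_iff₀ hp0] at hlt
  refine ⟨div_pos (by linarith) hβ, ?_, ?_, ?_⟩
  · rw [← mul_div_assoc, div_lt_one hβ]
    linarith
  · field_simp
    linarith
  · field_simp
    linarith

theorem intervalIntegral_const_mul_beta (C x y : ℝ) :
    ∫ τ in (0 : ℝ)..1, C * (1 - τ) ^ x * τ ^ y =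
      C * ∫ τ in Ioo (0 : ℝ) 1, (1 - τ) ^ x * τ ^ y := by
  rw [intervalIntegral.integral_of_le zero_le_one, integral_Ioc_eq_integral_Ioo,
    ← integral_const_mul]
  simp only [mul_assoc]

theorem constK₁_eq {β a σ α : ℝ} {p : ℕ} (C₁ : ℝ)
    (e₁ : (((p : ℝ) - 1) * a - σ) / β = p * (α / β) - α / β - 1) :
    constK₁ β a σ α p C₁ = C₁ * ∫ τ in Ioo (0 : ℝ) 1,
      (1 - τ) ^ (p * (α / β) - α / β - 1) * τ ^ (-(p * (α / β))) := by
  rw [constK₁, e₁, neg_div, mul_div_assoc, intervalIntegral_const_mul_beta]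

theorem constK₂_eq {β a σ α : ℝ} {p : ℕ} (C₂ : ℝ)
    (e₂ : (α + ((p : ℝ) - 1) * a - σ) / β = p * (α / β) - 1) :
    constK₂ β a σ α p C₂ = C₂ * ∫ τ in Ioo (0 : ℝ) 1,
      (1 - τ) ^ (p * (α / β) - 1) * τ ^ (-(p * (α / β))) := by
  rw [constK₂, show ((p : ℝ) - 1) * a - σ + α = α + ((p : ℝ) - 1) * a - σ by ring, e₂, neg_div,
    mul_div_assoc, intervalIntegral_const_mul_beta]

theorem mul_integral_beta_nonneg {C : ℝ} (hC : 0 ≤ C) (x y : ℝ) :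
    0 ≤ C * ∫ τ in Ioo (0 : ℝ) 1, (1 - τ) ^ x * τ ^ y :=
  mul_nonneg hC (setIntegral_nonneg measurableSet_Ioo fun τ hτ =>
    mul_nonneg (Real.rpow_nonneg (by linarith [hτ.2]) _) (Real.rpow_nonneg hτ.1.le _))

end Constants

section Bridge

variable {𝕜 : Type*} [RCLike 𝕜] {n : ℕ} {E : Type*} [NormedAddCommGroup E] [NormedSpace 𝕜 E]
  {p : ℕ} {β a σ α : ℝ} {ι : E →L[𝕜] Distr n 𝕜}
  {B : MultilinearMap 𝕜 (fun _ : Fin p => E) (Distr n 𝕜)}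
  {S : ℝ → E →L[𝕜] E} {G : ℝ → ContinuousMultilinearMap 𝕜 (fun _ : Fin p => E) E}

theorem rpow_mul_norm_le_of_solNorm_le {u : ℝ → E} {M : ℝ} (hM : 0 ≤ M)
    (h : solNorm β α ι u ≤ ENNReal.ofReal M) {t : ℝ} (ht : 0 < t) :
    t ^ (α / β) * ‖u t‖ ≤ M := by
  rw [← ofReal_mul_enorm_le_iff (Real.rpow_nonneg ht.le _) hM]
  exact ((le_iSup₂ (f := fun (t : ℝ) (_ : 0 < t) =>
    ENNReal.ofReal (t ^ (α / β)) * ‖u t‖ₑ) t ht).trans le_add_self).trans h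

theorem IsRealization.solNorm_le (h : IsRealization β ι B S G) {u : ℝ → E} {A D : ℝ}
    (hA0 : 0 ≤ A) (hD0 : 0 ≤ D)
    (hA : ∀ t, 0 < t → ∀ r, 0 < r → r ^ (α / β) * ‖S r (u t)‖ ≤ A)
    (hD : ∀ t, 0 < t → t ^ (α / β) * ‖u t‖ ≤ D) :
    solNorm β α ι u ≤ ENNReal.ofReal (A + D) := by
  rw [ENNReal.ofReal_add hA0 hD0]
  refine add_le_add (iSup₂_le fun t ht => ?_) (iSup₂_le fun t ht => ?_)
  · exact (BENorm_le_iff h.injective (fun r hr => h.heat r hr (u t)) hA0).2 (hA t ht)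
  · exact (ofReal_mul_enorm_le_iff (Real.rpow_nonneg ht.le _) hD0 _).2 (hD t ht)

theorem IsRealization.stronglyMeasurableBE (h : IsRealization β ι B S G) {u : ℝ → E}
    {U : ℝ → (Ioi (0 : ℝ) →ᵇ E)} (hU : ContinuousOn U (Ioi 0))
    (hUS : ∀ t, 0 < t → ∀ r : Ioi (0 : ℝ),
      U t r = (((r : ℝ) ^ (α / β) : ℝ) : 𝕜) • S r (u t)) :
    StronglyMeasurableBE β α ι u := by
  have h1 : (1 : ℝ) ∈ Ioi (0 : ℝ) := mem_Ioi.2 one_pos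
  set q := SimpleFunc.approxOn id measurable_id (Ioi (0 : ℝ)) 1 h1 with hq
  have hq0 : ∀ k t, 0 < q k t := fun k t => SimpleFunc.approxOn_mem measurable_id h1 k t
  refine ⟨fun k => (q k).map fun t => ι (u t), fun k t => ?_, ?_⟩
  · refine lt_of_le_of_lt ((BENorm_le_iff h.injective
      (fun r hr => h.heat r hr (u (q k t))) (norm_nonneg (U (q k t)))).2 fun r hr => ?_)
      ENNReal.ofReal_lt_top
    rw [← norm_rpow_smul (𝕜 := 𝕜) hr, ← hUS _ (hq0 k t) ⟨r, hr⟩]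
    exact (U (q k t)).norm_coe_le_norm _
  · filter_upwards [self_mem_ae_restrict measurableSet_Ioi] with t ht
    have ht0 : (0 : ℝ) < t := ht
    have hlim : Tendsto (fun k => ‖U (q k t) - U t‖) atTop (𝓝 0) := by
      rw [← tendsto_iff_norm_sub_tendsto_zero]
      refine (hU t ht).tendsto.comp (tendsto_nhdsWithin_iff.2
        ⟨SimpleFunc.tendsto_approxOn measurable_id h1 (subset_closure ht),
          Eventually.of_forall fun k => hq0 k t⟩)
    refine tendsto_of_tendsto_of_tendsto_of_le_of_le tendsto_const_nhds
      ((tendsto_ofReal_zero_iff (Eventually.of_forall fun _ => norm_nonneg _)).2 hlim)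
      (fun _ => zero_le) fun k => ?_
    rw [SimpleFunc.map_apply, ← map_sub]
    refine (BENorm_le_iff h.injective (fun r hr => h.heat r hr _) (norm_nonneg _)).2
      fun r hr => ?_
    rw [← norm_rpow_smul (𝕜 := 𝕜) hr, map_sub, smul_sub, ← hUS _ (hq0 k t) ⟨r, hr⟩,
      ← hUS t ht0 ⟨r, hr⟩]
    exact (U (q k t) - U t).norm_coe_le_norm _

theorem eq_of_solNorm_sub_eq_zero {u v : ℝ → E} (h : solNorm β α ι (u - v) ≤ 0) {t : ℝ}
    (ht : 0 < t) : u t = v t := by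
  rw [← ENNReal.ofReal_zero] at h
  have h1 := rpow_mul_norm_le_of_solNorm_le le_rfl h ht
  have h2 : 0 < t ^ (α / β) := by positivity
  have h3 : ‖(u - v) t‖ ≤ 0 := nonpos_of_mul_nonpos_right h1 h2
  exact sub_eq_zero.1 (norm_le_zero_iff.1 h3)

theorem IsRealization.BENorm_sub_self (h : IsRealization β ι B S G)
    (u₀ : Distr n 𝕜) : BENorm β α ι (u₀ - u₀) = 0 := by
  refine le_antisymm ?_ zero_le
  have h1 : ∀ t, 0 < t → IsHeat β t (u₀ - u₀) (ι (0 : E)) := fun t ht => by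
    have h0 := h.heat t ht 0
    rw [map_zero (S t)] at h0
    rwa [sub_self, ← map_zero ι]
  rw [← ENNReal.ofReal_zero, BENorm_le_iff h.injective h1 le_rfl]
  simp

variable [NormedSpace ℝ E]

theorem IsGlobalSolution.mild (h : IsRealization β ι B S G) {u₀ : Distr n 𝕜} {u y : ℝ → E}
    (hu : IsGlobalSolution β α ι B u₀ u) (hy : ∀ t, 0 < t → IsHeat β t u₀ (ι (y t))) {t : ℝ}
    (ht : 0 < t) : IntegrableOn (fun τ => G (t - τ) fun _ => u τ) (Ioo 0 t) ∧
      u t = y t + FracHeat.duhamel G u t := by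
  obtain ⟨y', f, hy', hf, hfi, hut⟩ := hu.duhamel t ht
  have hyy : y' = y t := h.injective (hy'.unique (hy t ht))
  have hfG : EqOn f (fun τ => G (t - τ) fun _ => u τ) (Ioo 0 t) := fun τ hτ =>
    h.injective ((hf τ hτ).unique (h.form _ (sub_pos.2 hτ.2) _))
  refine ⟨hfi.congr_fun hfG measurableSet_Ioo, ?_⟩
  rw [hut, hyy, FracHeat.duhamel, setIntegral_congr_fun measurableSet_Ioo hfG]

variable {C₁ C₂ κ₁ κ₂ M R : ℝ}

theorem IsRealization.exists_isGlobalSolution [CompleteSpace E] (h : IsRealization β ι B S G)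
    (hS : MildSystem S G (α / β) C₁ C₂)
    (hκ₁ : κ₁ = C₁ * ∫ σ in Ioo (0 : ℝ) 1,
      (1 - σ) ^ (p * (α / β) - α / β - 1) * σ ^ (-(p * (α / β))))
    (hκ₂ : κ₂ = C₂ * ∫ σ in Ioo (0 : ℝ) 1, (1 - σ) ^ (p * (α / β) - 1) * σ ^ (-(p * (α / β))))
    (hM : 0 ≤ M) (hR : 0 ≤ R) (hball : 2 * R + (κ₁ + κ₂) * M ^ p ≤ M)
    (hq : p * κ₁ * M ^ (p - 1) < 1) {u₀ : Distr n 𝕜} (hu₀ : BENorm β α ι u₀ ≤ ENNReal.ofReal R) :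
    ∃ u : ℝ → E, IsGlobalSolution β α ι B u₀ u ∧ solNorm β α ι u ≤ ENNReal.ofReal M := by
  have hκ₁0 : 0 ≤ κ₁ := hκ₁ ▸ mul_integral_beta_nonneg hS.nonneg.1 _ _
  have hκ₂0 : 0 ≤ κ₂ := hκ₂ ▸ mul_integral_beta_nonneg hS.nonneg.2 _ _
  have hb1 : 0 ≤ κ₁ * M ^ p := by positivity
  have hb2 : 0 ≤ κ₂ * M ^ p := by positivity
  obtain ⟨y, hy⟩ := exists_heat_orbit (hu₀.trans_lt ENNReal.ofReal_lt_top)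
  obtain ⟨u, U, hUc, hu⟩ := hS.exists_solution hκ₁ hκ₂ hM (by linarith) hq (h.orbit hy)
    ((BENorm_le_iff h.injective hy hR).1 hu₀)
  have hUS : ∀ t, 0 < t → ∀ r : Ioi (0 : ℝ),
      U t r = (((r : ℝ) ^ (α / β) : ℝ) : 𝕜) • S r (u t) := fun t ht => (hu t ht).2.2.2.2
  have hsol : solNorm β α ι u ≤ ENNReal.ofReal M := by
    refine (h.solNorm_le (A := R + κ₂ * M ^ p) (D := R + κ₁ * M ^ p) (by linarith) (by linarith)
      (fun t ht r hr => ?_) fun t ht => (hu t ht).2.2.1).trans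
      (ENNReal.ofReal_le_ofReal (by linarith))
    rw [← norm_rpow_smul (𝕜 := 𝕜) hr, ← hUS t ht ⟨r, hr⟩]
    exact ((U t).norm_coe_le_norm _).trans (hu t ht).2.2.2.1
  exact ⟨u, ⟨hsol.trans_lt ENNReal.ofReal_lt_top, h.stronglyMeasurableBE hUc hUS, fun t ht =>
    ⟨y t, fun τ => G (t - τ) fun _ => u τ, hy t ht, fun τ hτ => h.form _ (sub_pos.2 hτ.2) _,
      (hu t ht).1, (hu t ht).2.1⟩⟩, hsol⟩

theorem IsRealization.solNorm_sub_le [CompleteSpace E] (h : IsRealization β ι B S G)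
    (hS : MildSystem S G (α / β) C₁ C₂)
    (hκ₁ : κ₁ = C₁ * ∫ σ in Ioo (0 : ℝ) 1,
      (1 - σ) ^ (p * (α / β) - α / β - 1) * σ ^ (-(p * (α / β))))
    (hκ₂ : κ₂ = C₂ * ∫ σ in Ioo (0 : ℝ) 1, (1 - σ) ^ (p * (α / β) - 1) * σ ^ (-(p * (α / β))))
    (hM : 0 ≤ M) (hR : 0 ≤ R) (hq : p * (κ₁ + κ₂) * M ^ (p - 1) < 1)
    {u₀ v₀ : Distr n 𝕜} {u v : ℝ → E}
    (hu₀ : BENorm β α ι u₀ ≤ ENNReal.ofReal R) (hv₀ : BENorm β α ι v₀ ≤ ENNReal.ofReal R)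
    (hu : IsGlobalSolution β α ι B u₀ u) (hv : IsGlobalSolution β α ι B v₀ v)
    (huM : solNorm β α ι u ≤ ENNReal.ofReal M) (hvM : solNorm β α ι v ≤ ENNReal.ofReal M) :
    solNorm β α ι (u - v) ≤
      ENNReal.ofReal (2 * (1 - p * (κ₁ + κ₂) * M ^ (p - 1))⁻¹) * BENorm β α ι (u₀ - v₀) := by
  have hβ := h.pos
  have hκ₁0 : 0 ≤ κ₁ := hκ₁ ▸ mul_integral_beta_nonneg hS.nonneg.1 _ _
  have hκ₂0 : 0 ≤ κ₂ := hκ₂ ▸ mul_integral_beta_nonneg hS.nonneg.2 _ _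
  obtain ⟨y, hy⟩ := exists_heat_orbit (hu₀.trans_lt ENNReal.ofReal_lt_top)
  obtain ⟨z, hz⟩ := exists_heat_orbit (hv₀.trans_lt ENNReal.ofReal_lt_top)
  have hyz : ∀ t, 0 < t → IsHeat β t (u₀ - v₀) (ι (y t - z t)) := fun t ht => by
    rw [map_sub]
    exact IsHeat.sub hβ ht (hy t ht) (hz t ht)
  have hyR := (BENorm_le_iff h.injective hy hR).1 hu₀
  have hzR := (BENorm_le_iff h.injective hz hR).1 hv₀
  have hfin : BENorm β α ι (u₀ - v₀) < ∞ := by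
    refine lt_of_le_of_lt ((BENorm_le_iff h.injective hyz (R := 2 * R) (by linarith)).2
      fun t ht => ?_) ENNReal.ofReal_lt_top
    calc _ ≤ t ^ (α / β) * (‖y t‖ + ‖z t‖) := by gcongr; exact norm_sub_le _ _
      _ ≤ _ := by linarith [hyR t ht, hzR t ht]
  obtain ⟨d, hd0, hd⟩ : ∃ d : ℝ, 0 ≤ d ∧ BENorm β α ι (u₀ - v₀) = ENNReal.ofReal d :=
    ⟨_, ENNReal.toReal_nonneg, (ENNReal.ofReal_toReal hfin.ne).symm⟩
  have hyzd := (BENorm_le_iff h.injective hyz hd0).1 hd.le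
  have hut := fun t ht => rpow_mul_norm_le_of_solNorm_le hM huM (t := t) ht
  have hvt := fun t ht => rpow_mul_norm_le_of_solNorm_le hM hvM (t := t) ht
  have hui := fun t ht => (hu.mild h hy (t := t) ht).1
  have hvi := fun t ht => (hv.mild h hz (t := t) ht).1
  have hue := fun t ht => (hu.mild h hy (t := t) ht).2
  have hve := fun t ht => (hv.mild h hz (t := t) ht).2
  set q := p * (κ₁ + κ₂) * M ^ (p - 1) with hqdef
  have hq₁0 : 0 ≤ p * κ₁ * M ^ (p - 1) := by positivity
  have hq₂0 : 0 ≤ p * κ₂ * M ^ (p - 1) := by positivity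
  have hqq : q = p * κ₁ * M ^ (p - 1) + p * κ₂ * M ^ (p - 1) := by rw [hqdef]; ring
  obtain ⟨D, hD⟩ : ∃ D : ℝ, IsLUB ((fun t => t ^ (α / β) * ‖u t - v t‖) '' Ioi 0) D := by
    refine ⟨_, isLUB_csSup ⟨_, mem_image_of_mem _ (mem_Ioi.2 one_pos)⟩ ⟨2 * M, ?_⟩⟩
    rintro _ ⟨t, ht, rfl⟩
    have ht0 : (0 : ℝ) < t := ht
    calc t ^ (α / β) * ‖u t - v t‖ ≤ t ^ (α / β) * (‖u t‖ + ‖v t‖) := by gcongr; exact norm_sub_le _ _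
      _ ≤ _ := by linarith [hut t ht, hvt t ht]
  have hDt : ∀ t, 0 < t → t ^ (α / β) * ‖u t - v t‖ ≤ D := fun t ht => hD.1 ⟨t, ht, rfl⟩
  have hD0 : 0 ≤ D := le_trans (by positivity) (hDt 1 one_pos)
  have hDle : D ≤ d + p * κ₁ * M ^ (p - 1) * D := by
    refine hD.2 ?_
    rintro _ ⟨t, ht, rfl⟩
    have h1 := MildSystem.weighted_norm_sub_le hui hvi hue hve hut hvt hS hκ₁ hDt
      (show (0 : ℝ) < t from ht)
    dsimp only
    linarith [hyzd t ht]
  have hDq : D ≤ d / (1 - q) := by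
    rw [le_div_iff₀ (by linarith)]
    have : 0 ≤ p * κ₂ * M ^ (p - 1) * D := by positivity
    rw [hqq]
    linarith
  have hsub : solNorm β α ι (u - v) ≤
      ENNReal.ofReal ((d + p * κ₂ * M ^ (p - 1) * D) + (d + p * κ₁ * M ^ (p - 1) * D)) := by
    refine h.solNorm_le (by positivity) (by positivity) (fun t ht r hr => ?_) fun t ht =>
      (hDt t ht).trans hDle
    refine (MildSystem.weighted_norm_orbit_sub_le hui hvi hue hve hut hvt hS hκ₂ (h.orbit hy)
      (h.orbit hz) hDt hr ht).trans ?_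
    gcongr
    refine le_trans ?_ (hyzd (r + t) (add_pos hr ht))
    gcongr
    · exact hS.pos.le
    · linarith
  refine hsub.trans ?_
  have h1q : 0 < 1 - q := by linarith
  rw [hd, ← ENNReal.ofReal_mul (by positivity)]
  refine ENNReal.ofReal_le_ofReal ?_
  calc _ = 2 * d + q * D := by rw [hqq]; ring
    _ ≤ 2 * d + 2 * q * (d / (1 - q)) := by
        have hq0 : 0 ≤ q := by linarith
        have : 0 ≤ q * D := by positivity
        have := mul_le_mul_of_nonneg_left hDq hq0
        linarith
    _ = _ := by field_simp; ring

theorem IsRealization.tendsto_sub_iff (h : IsRealization β ι B S G)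
    (hS : MildSystem S G (α / β) C₁ C₂)
    (hκ₁ : κ₁ = C₁ * ∫ σ in Ioo (0 : ℝ) 1,
      (1 - σ) ^ (p * (α / β) - α / β - 1) * σ ^ (-(p * (α / β))))
    (hM : 0 ≤ M) (hq : p * κ₁ * M ^ (p - 1) < 1) {u₀ v₀ : Distr n 𝕜} {u v : ℝ → E}
    (hu₀ : BENorm β α ι u₀ < ∞) (hv₀ : BENorm β α ι v₀ < ∞)
    (hu : IsGlobalSolution β α ι B u₀ u) (hv : IsGlobalSolution β α ι B v₀ v)
    (huM : solNorm β α ι u ≤ ENNReal.ofReal M) (hvM : solNorm β α ι v ≤ ENNReal.ofReal M) :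
    Tendsto (fun t : ℝ => t ^ (α / β) * ‖u t - v t‖) atTop (𝓝 0) ↔
      Tendsto (fun t : ℝ => ENNReal.ofReal (t ^ (α / β)) * heatNorm β ι t (u₀ - v₀))
        atTop (𝓝 0) := by
  obtain ⟨y, hy⟩ := exists_heat_orbit hu₀
  obtain ⟨z, hz⟩ := exists_heat_orbit hv₀
  rw [MildSystem.tendsto_sub_iff (fun t ht => (hu.mild h hy ht).1)
    (fun t ht => (hv.mild h hz ht).1) (fun t ht => (hu.mild h hy ht).2)
    (fun t ht => (hv.mild h hz ht).2) (fun t ht => rpow_mul_norm_le_of_solNorm_le hM huM ht)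
    (fun t ht => rpow_mul_norm_le_of_solNorm_le hM hvM ht) hS hκ₁ hq,
    ← tendsto_ofReal_zero_iff]
  · refine tendsto_congr' ?_
    filter_upwards [eventually_gt_atTop 0] with t ht
    have hyz : IsHeat β t (u₀ - v₀) (ι (y t - z t)) := by
      rw [map_sub]
      exact IsHeat.sub h.pos ht (hy t ht) (hz t ht)
    rw [heatNorm_eq h.injective hyz, ofReal_mul_enorm_eq (Real.rpow_nonneg ht.le _)]
  · filter_upwards [eventually_gt_atTop 0] with t ht
    positivity

end Bridge

theorem mul_pow_pred_lt_one {p : ℕ} (hp : 1 < p) {K M R : ℝ} (hM : 0 < M) (hR : 0 < R)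
    (h : 2 * R + p * K * M ^ p < M) : p * K * M ^ (p - 1) < 1 := by
  have h1 : M ^ p = M ^ (p - 1) * M := (pow_sub_one_mul (by lia) M).symm
  rw [h1, ← mul_assoc] at h
  by_contra hne
  nlinarith

end FracHeat

open FracHeat in
theorem theorem1p4 {𝕜 : Type*} [RCLike 𝕜] {n : ℕ} (hn : 0 < n)
    {E : Type*} [NormedAddCommGroup E] [NormedSpace 𝕜 E] [NormedSpace ℝ E] [IsScalarTower ℝ 𝕜 E]
    [CompleteSpace E]
    {p : ℕ} (hp : 1 < p) {β a σ α : ℝ} (hβ : 0 < β)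
    (ι : E →L[𝕜] Distr n 𝕜) (B : MultilinearMap 𝕜 (fun _ : Fin p => E) (Distr n 𝕜))
    (hB : FormScaling ι B σ) (hE : SpaceScaling ι a) (hX : InClassX β ι) (hA : Adequate β ι B)
    (h₁ : (β - σ) / ((p : ℝ) - 1) - β / p < -a) (h₂ : -a < (β - σ) / ((p : ℝ) - 1))
    (hα : α = (β - σ) / ((p : ℝ) - 1) + a) :
    -- constants `C₁`, `C₂` in the two basic estimates exist
    ((∃ C₁, 0 < C₁ ∧ EstimateE β a σ ι B C₁) ∧ (∃ C₂, 0 < C₂ ∧ EstimateBE β a σ α ι B C₂)) ∧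
    -- and for all such constants, with `K₁`, `K₂` and `K = K₁ + K₂` built from them:
    ∀ C₁ C₂ : ℝ, 0 < C₁ → 0 < C₂ → EstimateE β a σ ι B C₁ → EstimateBE β a σ α ι B C₂ →
    ∀ K₁ K₂ K : ℝ, K₁ = constK₁ β a σ α p C₁ → K₂ = constK₂ β a σ α p C₂ → K = K₁ + K₂ →
    ∀ M R : ℝ, 0 < M → 0 < R → 2 * R + p * K * M ^ p < M →
      -- existence and uniqueness
      (∀ u₀ : Distr n 𝕜, BENorm β α ι u₀ ≤ ENNReal.ofReal R →
        ∃ u : ℝ → E, (IsGlobalSolution β α ι B u₀ u ∧ solNorm β α ι u ≤ ENNReal.ofReal M) ∧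
          ∀ v : ℝ → E, IsGlobalSolution β α ι B u₀ v → solNorm β α ι v ≤ ENNReal.ofReal M →
            ∀ t, 0 < t → v t = u t) ∧
      ∀ (u₀ v₀ : Distr n 𝕜) (u v : ℝ → E),
        BENorm β α ι u₀ ≤ ENNReal.ofReal R → BENorm β α ι v₀ ≤ ENNReal.ofReal R →
        IsGlobalSolution β α ι B u₀ u → IsGlobalSolution β α ι B v₀ v →
        solNorm β α ι u ≤ ENNReal.ofReal M → solNorm β α ι v ≤ ENNReal.ofReal M →
        -- Lipschitz dependence on the data
        solNorm β α ι (u - v) ≤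
          ENNReal.ofReal (2 * (1 - p * K * M ^ (p - 1))⁻¹) * BENorm β α ι (u₀ - v₀) ∧
        -- asymptotic equivalence
        (p * K₁ * M ^ (p - 1) < 1 →
          (Tendsto (fun t : ℝ => t ^ (α / β) * ‖u t - v t‖) atTop (𝓝 0) ↔
            Tendsto (fun t : ℝ => ENNReal.ofReal (t ^ (α / β)) * heatNorm β ι t (u₀ - v₀))
              atTop (𝓝 0))) := by
  obtain ⟨hθ, hpθ, e₁, e₂⟩ := exponent_identities hp hβ h₁ h₂ hα
  have hι := hA.injective
  obtain ⟨S, hSc, hS⟩ := hA.exists_heat_operator hβ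
  refine ⟨?_, fun C₁ C₂ hC₁ hC₂ hE₁ hE₂ K₁ K₂ K hK₁ hK₂ hK M R hM hR hMR => ?_⟩
  · obtain ⟨C₁, hC₁, hE₁⟩ := hA.exists_estimateE hβ hE hB
    obtain ⟨G, hG⟩ := hE₁.exists_form hβ hι hC₁.le
    have hreal : IsRealization β ι B S G := ⟨hβ, hι, hS, fun t ht => (hG t ht).2⟩
    have hα0 : 0 < α := (div_pos_iff_of_pos_right hβ).1 hθ
    have hneg : (α + ((p : ℝ) - 1) * a - σ) / β < 0 := by linarith
    refine ⟨⟨C₁, hC₁, hE₁⟩, C₁, hC₁, hreal.estimateBE hC₁.le (fun t ht => (hG t ht).1) hα0.le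
      ?_⟩
    have := mul_neg_of_neg_of_pos hneg hβ
    rw [div_mul_cancel₀ _ hβ.ne'] at this
    exact this.le
  obtain ⟨G, hG⟩ := hE₁.exists_form hβ hι hC₁.le
  have hreal : IsRealization β ι B S G := ⟨hβ, hι, hS, fun t ht => (hG t ht).2⟩
  have hsys := hreal.mildSystem hSc hC₁.le hC₂.le hp hθ hpθ rfl e₁ e₂ (fun t ht => (hG t ht).1)
    hE₂
  rw [constK₁_eq C₁ e₁] at hK₁
  rw [constK₂_eq C₂ e₂] at hK₂
  have hK₁0 : 0 ≤ K₁ := hK₁ ▸ mul_integral_beta_nonneg hC₁.le _ _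
  have hK₂0 : 0 ≤ K₂ := hK₂ ▸ mul_integral_beta_nonneg hC₂.le _ _
  subst hK
  have hq := mul_pow_pred_lt_one hp hM hR hMR
  have hp1 : (1 : ℝ) ≤ p := by exact_mod_cast hp.le
  have hball : 2 * R + (K₁ + K₂) * M ^ p ≤ M := by
    have : (K₁ + K₂) * M ^ p ≤ p * ((K₁ + K₂) * M ^ p) :=
      le_mul_of_one_le_left (by positivity) hp1
    linarith
  have hq₁ : p * K₁ * M ^ (p - 1) < 1 := by
    refine lt_of_le_of_lt ?_ hq
    gcongr
    linarith
  have hlip := fun u₀ v₀ u v => hreal.solNorm_sub_le hsys hK₁ hK₂ hM.le hR.le hq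
    (u₀ := u₀) (v₀ := v₀) (u := u) (v := v)
  refine ⟨fun u₀ hu₀ => ?_, fun u₀ v₀ u v hu₀ hv₀ hu hv huM hvM => ⟨hlip u₀ v₀ u v hu₀ hv₀ hu hv
    huM hvM, fun hq' => hreal.tendsto_sub_iff hsys hK₁ hM.le hq'
      (hu₀.trans_lt ENNReal.ofReal_lt_top) (hv₀.trans_lt ENNReal.ofReal_lt_top) hu hv huM hvM⟩⟩
  obtain ⟨u, hu, huM⟩ := hreal.exists_isGlobalSolution hsys hK₁ hK₂ hM.le hR.le hball hq₁ hu₀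
  refine ⟨u, ⟨hu, huM⟩, fun v hv hvM t ht => eq_of_solNorm_sub_eq_zero (ι := ι) (β := β) (α := α) ?_ ht⟩
  refine (hlip u₀ u₀ v u hu₀ hu₀ hv hu hvM huM).trans ?_
  rw [hreal.BENorm_sub_self, mul_zero]
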